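/- **Setting.** Let $m,d,n,T\ge 1$. Features lie in a set $X\subseteq\mathbb R^m$ with $\|x\|_2\le K_X$ and have an arbitrary law $D_x$ on $X$. The action space $W\subseteq\mathbb R^d$ is continuous: a measurable subset of the unit $\ell^2$-ball with positive Lebesgue measure. The label of feature $x$ under action $w$ is $c=Fx+Gw+\varepsilon$ with $F,G$ fixed unknown matrices and $\varepsilon\sim\mathcal N(0,\sigma^2I_d)$; the cost of action $w$ is $u=c^{\dagger}w+\mu^{\dagger}w+\eta$ with $\mu\in\mathbb R^d$ fixed and unknown and $\eta\sim\mathcal N(0,\sigma^2)$, and besides $c$ the number $u_b=\mu^\dagger w+\eta$ is observed. Assume $\|Fx+Gw\|_2\le K_C$ for all $x\in X$, $w\in W$, that $\|\mu\|_2\le K_\mu$, that $m\le\kappa n$, and that for $x\sim D_x$ and $w$ uniform on $W$, independent, all eigenvalues of the second moment matrix $\mathbb E\left[\binom{x}{w}\binom{x}{w}^{\dagger}\right]$ are at least $K_\Sigma/(m+d)$, where $K_\Sigma>0$. In each round $t=0,1,\dots,T$ there are $n$ individuals with features $x_i^t\sim D_x$; all features, exploratory actions and noises are independent over rounds and individuals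 and of each other. Round $0$ is an initial dataset with arbitrary default actions $w_i^0\in W$, which may depend on the features of that round but not on its noises. **Algorithm** (explore-then-exploit PROOF, with parameter $\gamma\in(0,1]$ and exploration length $\tilde T$). Let $b_1,\dots,b_d\in W$ be a barycentric spanner of $W$ (every $w\in W$ is $\sum_j a_jb_j$ with $|a_j|\le1$), and put $$A_i^t=\sum_{j=1}^d b_jb_j^{\dagger}+\sum_{s=1}^{t-1}w_i^s(w_i^s)^{\dagger},\qquad \hat\mu_i^t=(A_i^t)^{-1}\sum_{s=1}^{t-1}u_{b,i}^s\,w_i^s,$$ $$\beta^t=\max\left(128\,d\log t\,\log\tfrac{nt^2}{\gamma},\ \left(\tfrac83\log\tfrac{nt^2}{\gamma}\right)^2\right),\qquad B_i^t=\left\{\nu:\ (\nu-\hat\mu_i^t)^{\dagger}A_i^t(\nu-\hat\mu_i^t)\le\beta^t\right\}.$$ In the rounds $1\le t\le\min(\tilde T,T)$ each $w_i^t$ is drawn uniformly at random from $W$. In the rounds $\tilde T<t\le T$ an ordinary least squares fit $(\hat F,\hat G)$ of the labels on (feature, action) is computed from all data of the rounds $0,\dots,t-1$, and $w_i^t\in\arg\min_{w\in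 W}\min_{\nu\in B_i^t}(\hat Fx_i^t+\hat Gw+\nu)^{\dagger}w$. Ties are broken measurably, and the actions of a round depend only on what has been observed before its labels and costs are revealed. **Regret.** Let $\pi(x)\in\arg\min_{w\in W}\mathbb E[u\mid x,w]$ be a measurable optimal policy and $$R_T=\mathbb E\left[\sum_{t=1}^T\sum_{i=1}^n\left(u_i^t(w_i^t)-u_i^t(\pi(x_i^t))\right)\right],$$ where $u_i^t(w)$ is the cost that action $w$ incurs for individual $i$ in round $t$. **Theorem.** There are an absolute constant $p\in\mathbb N$ and, for all $\sigma\ge0$, $K_X,K_C,K_\mu,\kappa$ and $K_\Sigma>0$, a constant $C$ depending only on these six numbers, such that for all $m,d,n,T\ge1$, all $\gamma\in(0,1]$, and $\tilde T$ equal to $m^{1/3}d^{2/3}T^{2/3}$ rounded down or up to an integer, the expectation defining $R_T$ exists and $$R_T\le C\left(1+\log\tfrac{nT}{\gamma}\right)^{p}m^{1/3}d^{2/3}\,n\,T^{2/3}.$$ That is, the regret is $\tilde O\left(m^{1/3}d^{2/3}nT^{2/3}\right)$. -/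

import Mathlib

open MeasureTheory ProbabilityTheory
open scoped Matrix NNReal

noncomputable section

namespace PROOFBandit

/-- Euclidean norm of a coordinate vector. -/
def l2norm {k : ℕ} (v : Fin k → ℝ) : ℝ := √(v ⬝ᵥ v)

/-- An environment: features in `X ⊆ ℝ^m` with marginal law `Dx`, actions in `W ⊆ ℝ^d`, labels
`c = F x + G w + ε` with `ε ∼ N(0, σ² I)`, and the unknown part `q(w) = μᵀ w + η` of the cost,
`η ∼ N(0, σ²)`. -/
structure Env (m d : ℕ) where
  X : Set (Fin m → ℝ)
  Dx : Measure (Fin m → ℝ)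
  W : Set (Fin d → ℝ)
  F : Matrix (Fin d) (Fin m) ℝ
  G : Matrix (Fin d) (Fin d) ℝ
  μ : Fin d → ℝ
  σ : ℝ≥0

namespace Env

variable {m d : ℕ} (E : Env m d)

/-- Uniform distribution on the action space (normalized Lebesgue measure). -/
def unif : Measure (Fin d → ℝ) := ProbabilityTheory.cond volume E.W

/-- Law `N(0, σ² I_d)` of the label noise. -/
def labelNoise : Measure (Fin d → ℝ) := Measure.pi fun _ => gaussianReal 0 (E.σ ^ 2)

/-- Law `N(0, σ²)` of the cost noise. -/
def costNoise : Measure ℝ := gaussianReal 0 (E.σ ^ 2)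

/-- Label of feature `x` under action `w` when the label noise is `e`. -/
def label (x : Fin m → ℝ) (w e : Fin d → ℝ) : Fin d → ℝ := E.F *ᵥ x + E.G *ᵥ w + e

/-- Cost `p(c, w) + q(w) + η = cᵀ w + μᵀ w + η` of action `w`, with `c` the label under `w`. -/
def cost (x : Fin m → ℝ) (e : Fin d → ℝ) (h : ℝ) (w : Fin d → ℝ) : ℝ :=
  E.label x w e ⬝ᵥ w + (E.μ ⬝ᵥ w + h)

/-- Expected cost of action `w` given feature `x` (over the label and the cost noise). -/
def expectedCost (x : Fin m → ℝ) (w : Fin d → ℝ) : ℝ :=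
  ∫ e, ∫ h, E.cost x e h w ∂E.costNoise ∂E.labelNoise

/-- `π` is an optimal policy: `π x` minimizes the expected cost given `x` over `W`. -/
structure IsOptimalPolicy (π : (Fin m → ℝ) → (Fin d → ℝ)) : Prop where
  measurable : Measurable π
  mem : ∀ x ∈ E.X, π x ∈ E.W
  le : ∀ x ∈ E.X, ∀ w ∈ E.W, E.expectedCost x (π x) ≤ E.expectedCost x w

/-- Standing assumptions: bounded features, a continuous action space (so that it carries a uniform
distribution) inside the unit Euclidean ball, bounded mean labels and bounded `μ`, and a lower bound
on the eigenvalues of the second moment matrix of the regressor `(x, w)`, `x ∼ Dx`, `w` uniform.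
As `‖(x, w)‖² ≤ KX² + 1`, these eigenvalues are at most `(KX² + 1) / (m + d)` on average, whence the
normalization by `m + d`, which lets `KS` be a constant while `m` and `d` grow. -/
structure IsRegular (KX KC Kμ KS : ℝ) : Prop where
  prob : IsProbabilityMeasure E.Dx
  ae_mem : ∀ᵐ x ∂E.Dx, x ∈ E.X
  norm_feature : ∀ x ∈ E.X, l2norm x ≤ KX
  measurableSet_action : MeasurableSet E.W
  volume_pos : 0 < volume E.W
  norm_action : ∀ w ∈ E.W, l2norm w ≤ 1
  norm_label : ∀ x ∈ E.X, ∀ w ∈ E.W, l2norm (E.F *ᵥ x + E.G *ᵥ w) ≤ KC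
  norm_mu : l2norm E.μ ≤ Kμ
  eigenvalue : ∀ (a : Fin m → ℝ) (b : Fin d → ℝ),
    KS / (m + d) * (a ⬝ᵥ a + b ⬝ᵥ b) ≤
      ∫ z, (a ⬝ᵥ z.1 + b ⬝ᵥ z.2) ^ 2 ∂(E.Dx.prod E.unif)

end Env

/-- The primitive random variables for round `t` and individual `i`: feature `x t i`, random action
`u t i` (used when exploring), label noise `e t i`, cost noise `η t i`.
Round `0` is the initial dataset. -/
structure Primitives (m d n : ℕ) (Ω : Type*) where
  x : ℕ → Fin n → Ω → (Fin m → ℝ)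
  u : ℕ → Fin n → Ω → (Fin d → ℝ)
  e : ℕ → Fin n → Ω → (Fin d → ℝ)
  η : ℕ → Fin n → Ω → ℝ

namespace Primitives

variable {m d n : ℕ} {Ω : Type*} (S : Primitives m d n Ω)

/-- All primitives of round `t` and individual `i`, as one random variable. -/
def all (t : ℕ) (i : Fin n) (ω : Ω) :
    (Fin m → ℝ) × (Fin d → ℝ) × (Fin d → ℝ) × ℝ :=
  (S.x t i ω, S.u t i ω, S.e t i ω, S.η t i ω)

/-- The primitives are mutually independent, with the laws prescribed by the environment. -/
structure IsSample [MeasurableSpace Ω] (P : Measure Ω) (E : Env m d) : Prop where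
  measurable : ∀ t i, Measurable (S.all t i)
  indep : iIndepFun (fun (k : ℕ × Fin n) => S.all k.1 k.2) P
  law : ∀ t i, P.map (S.all t i) =
    E.Dx.prod (E.unif.prod (E.labelNoise.prod E.costNoise))

/-- Information available when the actions of round `t` are chosen: everything about the earlier
rounds, and the features and the randomization of round `t`. -/
@[reducible] def info (t : ℕ) : MeasurableSpace Ω :=
  (⨆ s : Fin t, ⨆ i : Fin n, MeasurableSpace.comap (S.all s i) inferInstance) ⊔
    ⨆ i : Fin n, MeasurableSpace.comap (fun ω => (S.x t i ω, S.u t i ω)) inferInstance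

end Primitives

/-- `b` is a barycentric spanner of `W`. -/
def IsBarycentricSpanner {d : ℕ} (W : Set (Fin d → ℝ)) (b : Fin d → Fin d → ℝ) : Prop :=
  (∀ j, b j ∈ W) ∧ ∀ w ∈ W, ∃ a : Fin d → ℝ, (∀ j, |a j| ≤ 1) ∧ w = ∑ j, a j • b j

/-- Squared radius `β^t` of the confidence balls. -/
def radius (d n : ℕ) (γ : ℝ) (t : ℕ) : ℝ :=
  max (128 * d * Real.log t * Real.log (n * (t : ℝ) ^ 2 / γ))
    ((8 / 3 * Real.log (n * (t : ℝ) ^ 2 / γ)) ^ 2)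

section Algorithm

variable {m d n : ℕ} {Ω : Type*} (E : Env m d) (S : Primitives m d n Ω)
  (w : ℕ → Fin n → Ω → (Fin d → ℝ))

/-- Observed label of individual `i` in round `t`. -/
def obsLabel (t : ℕ) (i : Fin n) (ω : Ω) : Fin d → ℝ :=
  E.label (S.x t i ω) (w t i ω) (S.e t i ω)

/-- Observed bandit part `μᵀ w + η` of the cost. -/
def obsBandit (t : ℕ) (i : Fin n) (ω : Ω) : ℝ := E.μ ⬝ᵥ w t i ω + S.η t i ω

/-- Sum of squared residuals of the linear predictor `(x, w) ↦ F' x + G' w` on the data of the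
rounds `0, …, t - 1`. -/
def squaredLoss (t : ℕ) (ω : Ω) (F' : Matrix (Fin d) (Fin m) ℝ) (G' : Matrix (Fin d) (Fin d) ℝ) :
    ℝ :=
  ∑ s ∈ Finset.range t, ∑ i : Fin n,
    l2norm (obsLabel E S w s i ω - (F' *ᵥ S.x s i ω + G' *ᵥ w s i ω)) ^ 2

/-- `(F', G')` is an ordinary least squares fit to the data of the rounds `0, …, t - 1`. -/
def IsOLS (t : ℕ) (ω : Ω) (F' : Matrix (Fin d) (Fin m) ℝ) (G' : Matrix (Fin d) (Fin d) ℝ) : Prop :=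
  ∀ F'' G'', squaredLoss E S w t ω F' G' ≤ squaredLoss E S w t ω F'' G''

/-- `A_i^t = ∑_j b_j b_jᵀ + ∑_{1 ≤ s < t} w_i^s (w_i^s)ᵀ`. -/
def gram (b : Fin d → Fin d → ℝ) (t : ℕ) (i : Fin n) (ω : Ω) : Matrix (Fin d) (Fin d) ℝ :=
  ∑ j, Matrix.vecMulVec (b j) (b j) +
    ∑ s ∈ Finset.Ico 1 t, Matrix.vecMulVec (w s i ω) (w s i ω)

/-- `μ̂_i^t = (A_i^t)⁻¹ ∑_{1 ≤ s < t} u_{b,i}^s w_i^s`. -/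
def muHat (b : Fin d → Fin d → ℝ) (t : ℕ) (i : Fin n) (ω : Ω) : Fin d → ℝ :=
  (gram w b t i ω)⁻¹ *ᵥ ∑ s ∈ Finset.Ico 1 t, obsBandit E S w s i ω • w s i ω

/-- Confidence ball `B_i^t = {ν : ‖ν - μ̂_i^t‖_{2, A_i^t} ≤ √β^t}`. -/
def confBall (b : Fin d → Fin d → ℝ) (γ : ℝ) (t : ℕ) (i : Fin n) (ω : Ω) : Set (Fin d → ℝ) :=
  {ν | √((ν - muHat E S w b t i ω) ⬝ᵥ gram w b t i ω *ᵥ (ν - muHat E S w b t i ω)) ≤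
    √(radius d n γ t)}

/-- `v` minimizes `w ↦ min_{ν ∈ B} (ĉ(w) + ν)ᵀ w` over `W`, the inner minimum being attained. -/
def IsOptimisticChoice (W B : Set (Fin d → ℝ)) (chat : (Fin d → ℝ) → (Fin d → ℝ))
    (v : Fin d → ℝ) : Prop :=
  v ∈ W ∧ ∃ ν ∈ B, ∀ v' ∈ W, ∀ ν' ∈ B, (chat v + ν) ⬝ᵥ v ≤ (chat v' + ν') ⬝ᵥ v'

/-- `w` is the sequence of actions of the explore-then-exploit variant of PROOF with barycentric
spanner `b`, confidence parameter `γ`, exploration length `T₀` and horizon `T`.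
Ties (in the regression and in the choice of the action) are broken arbitrarily, but without looking
at anything that is not yet observed. -/
structure IsRun (b : Fin d → Fin d → ℝ) (γ : ℝ) (T₀ T : ℕ) : Prop where
  spanner : IsBarycentricSpanner E.W b
  adapted : ∀ t ≤ T, ∀ i, Measurable[S.info t] (w t i)
  initial : ∀ i ω, w 0 i ω ∈ E.W
  explore : ∀ t, 1 ≤ t → t ≤ T₀ → t ≤ T → ∀ i, w t i = S.u t i
  exploit : ∀ t, T₀ < t → t ≤ T → ∀ ω,
    ∃ Fhat Ghat, IsOLS E S w t ω Fhat Ghat ∧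
      ∀ i, IsOptimisticChoice E.W (confBall E S w b γ t i ω)
        (fun v => Fhat *ᵥ S.x t i ω + Ghat *ᵥ v) (w t i ω)

/-- Total cost of the actions `w` minus that of the policy `π` in the rounds `1, …, T`. -/
def excessCost (π : (Fin m → ℝ) → (Fin d → ℝ)) (T : ℕ) (ω : Ω) : ℝ :=
  ∑ t ∈ Finset.Icc 1 T, ∑ i : Fin n,
    (E.cost (S.x t i ω) (S.e t i ω) (S.η t i ω) (w t i ω) -
      E.cost (S.x t i ω) (S.e t i ω) (S.η t i ω) (π (S.x t i ω)))

/-- The regret `R_T`. -/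
def regret [MeasurableSpace Ω] (P : Measure Ω) (π : (Fin m → ℝ) → (Fin d → ℝ)) (T : ℕ) : ℝ :=
  ∫ ω, excessCost E S w π T ω ∂P

end Algorithm

end PROOFBandit

end

/-!
The excess cost of the action `v` over the action `v'` at the feature `x` is a fixed function of the
true parameters, and optimism bounds it in an exploitation round by twice the error of the predicted
cost: the least squares error of the label plus the error of the ridge estimate `muHat` plus the
width of the confidence ball.

Both estimation errors are controlled by two facts. First, by Chebyshev's inequality in whitened
coordinates the explored data have, outside an event of small probability, a Gram matrix of at least
half its mean, and the mean is bounded below by the eigenvalue assumption. Second, the noise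
enters through the adapted sums `∑ noise * ⟪v, z⟫ - τ * ⟪v, z⟫ ^ 2`, whose exponentials are
supermartingales for each fixed `v`; a union bound over a polynomially fine grid of directions makes
this uniform in `v` at the price of a logarithm. Since the actions after exploration only enlarge
the Gram matrix, the errors decay like the inverse square root of the number of explored data
points.

Exploring for `ρ = m ^ (1 / 3) * d ^ (2 / 3) * T ^ (2 / 3)` rounds leaves an error of order `ρ / T`
in each of the remaining rounds. If `T < 8 * ρ`, the bound is trivial.
-/

noncomputable section

namespace PROOFBandit

/-! ### Independence of the noises from the past -/

section Independence

variable {m d n : ℕ}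

lemma sq_l2norm {k : ℕ} (v : Fin k → ℝ) : l2norm v ^ 2 = v ⬝ᵥ v :=
  Real.sq_sqrt (by simpa using dotProduct_star_self_nonneg v)

lemma l2norm_le_iff {k : ℕ} {v : Fin k → ℝ} {r : ℝ} (hr : 0 ≤ r) :
    l2norm v ≤ r ↔ v ⬝ᵥ v ≤ r ^ 2 := by
  rw [← sq_l2norm, pow_le_pow_iff_left₀ (by exact Real.sqrt_nonneg _) hr two_ne_zero]

lemma indep_sup_comap {Ω α β : Type*} {H mΩ : MeasurableSpace Ω} [MeasurableSpace α]
    [MeasurableSpace β] {P : Measure Ω} [IsProbabilityMeasure P] {A : Ω → α} {N : Ω → β}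
    (hH : H ≤ mΩ) (hA : Measurable A) (hN : Measurable N)
    (hHAN : Indep H (MeasurableSpace.comap (fun ω => (A ω, N ω)) inferInstance) P)
    (hAN : IndepFun A N P) :
    Indep (H ⊔ MeasurableSpace.comap A inferInstance) (MeasurableSpace.comap N inferInstance)
      P := by
  let rectangles : Set (Set Ω) :=
    {s | ∃ h a, MeasurableSet[H] h ∧ MeasurableSet a ∧ s = h ∩ A ⁻¹' a}
  have hpi : IsPiSystem rectangles := by
    rintro _ ⟨h, a, hh, ha, rfl⟩ _ ⟨h', a', hh', ha', rfl⟩ -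
    exact ⟨h ∩ h', a ∩ a', hh.inter hh', ha.inter ha', by
      rw [Set.preimage_inter, Set.inter_inter_inter_comm]⟩
  have hgen : H ⊔ MeasurableSpace.comap A inferInstance =
      MeasurableSpace.generateFrom rectangles := by
    refine le_antisymm (sup_le (fun s hs => ?_) ?_) (MeasurableSpace.generateFrom_le ?_)
    · exact MeasurableSpace.measurableSet_generateFrom
        ⟨s, Set.univ, hs, MeasurableSet.univ, by simp⟩
    · rintro _ ⟨a, ha, rfl⟩
      exact MeasurableSpace.measurableSet_generateFrom
        ⟨Set.univ, a, MeasurableSet.univ, ha, by simp⟩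
    · rintro _ ⟨h, a, hh, ha, rfl⟩
      exact (le_sup_left (a := H) _ hh).inter (le_sup_right (a := H) _ ⟨a, ha, rfl⟩)
  refine IndepSets.indep (p1 := rectangles) (sup_le hH hA.comap_le) hN.comap_le hpi
    (@MeasurableSpace.isPiSystem_measurableSet _ (MeasurableSpace.comap N inferInstance)) hgen
    (@MeasurableSpace.generateFrom_measurableSet _ (MeasurableSpace.comap N inferInstance)).symm ?_
  rw [IndepSets_iff]
  rintro _ _ ⟨h, a, hh, ha, rfl⟩ ⟨b, hb, rfl⟩
  rw [Indep_iff] at hHAN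
  have hhab := hHAN h _ hh ⟨a ×ˢ b, ha.prod hb, rfl⟩
  have hha := hHAN h _ hh ⟨a ×ˢ Set.univ, ha.prod MeasurableSet.univ, rfl⟩
  rw [Set.mk_preimage_prod] at hhab hha
  rw [Set.preimage_univ, Set.inter_univ] at hha
  rw [Set.inter_assoc, hhab, hha, hAN.measure_inter_preimage_eq_mul a b ha hb, mul_assoc]

lemma lintegral_mul_le_of_indepFun {Ω β γ : Type*} [MeasurableSpace Ω]
    [MeasurableSpace β] [MeasurableSpace γ] {P : Measure Ω} [IsProbabilityMeasure P]
    {Y : Ω → ENNReal} {Q : Ω → β} {N : Ω → γ} {φ : β → γ → ENNReal} (hY : Measurable Y)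
    (hQ : Measurable Q) (hN : Measurable N) (hφ : Measurable (Function.uncurry φ))
    (hindep : IndepFun (fun ω => (Y ω, Q ω)) N P) (hφ_le : ∀ q, ∫⁻ y, φ q y ∂(P.map N) ≤ 1) :
    ∫⁻ ω, Y ω * φ (Q ω) (N ω) ∂P ≤ ∫⁻ ω, Y ω ∂P := by
  have := Measure.isProbabilityMeasure_map (μ := P) hN.aemeasurable
  have hYQ := hY.prodMk hQ
  have hf : Measurable fun z : (ENNReal × β) × γ => z.1.1 * φ z.1.2 z.2 :=
    measurable_fst.fst.mul (hφ.comp (measurable_fst.snd.prodMk measurable_snd))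
  calc ∫⁻ ω, Y ω * φ (Q ω) (N ω) ∂P
      = ∫⁻ z, z.1.1 * φ z.1.2 z.2 ∂(P.map fun ω => ((Y ω, Q ω), N ω)) :=
        (lintegral_map hf (hYQ.prodMk hN)).symm
    _ = ∫⁻ z, z.1 * ∫⁻ y, φ z.2 y ∂(P.map N) ∂(P.map fun ω => (Y ω, Q ω)) := by
        rw [(indepFun_iff_map_prod_eq_prod_map_map hYQ.aemeasurable hN.aemeasurable).1 hindep,
          lintegral_prod _ hf.aemeasurable]
        exact lintegral_congr fun z => lintegral_const_mul z.1
          (hφ.comp (measurable_prodMk_left (x := z.2)))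
    _ ≤ ∫⁻ z, z.1 ∂(P.map fun ω => (Y ω, Q ω)) :=
        lintegral_mono fun z => mul_le_of_le_one_right' (hφ_le z.2)
    _ = ∫⁻ ω, Y ω ∂P := lintegral_map measurable_fst hYQ

namespace Env

variable {E : Env m d} {KX KC Kμ KS : ℝ}

lemma IsRegular.dotProduct_feature_le (hE : E.IsRegular KX KC Kμ KS) {x : Fin m → ℝ}
    (hx : x ∈ E.X) : x ⬝ᵥ x ≤ KX ^ 2 :=
  (l2norm_le_iff ((Real.sqrt_nonneg _).trans (hE.norm_feature x hx))).1 (hE.norm_feature x hx)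

lemma IsRegular.dotProduct_action_le (hE : E.IsRegular KX KC Kμ KS) {w : Fin d → ℝ}
    (hw : w ∈ E.W) : w ⬝ᵥ w ≤ 1 := by
  simpa using (l2norm_le_iff zero_le_one).1 (hE.norm_action w hw)

lemma IsRegular.volume_action_lt_top (hE : E.IsRegular KX KC Kμ KS) : volume E.W < ⊤ := by
  refine (measure_mono (t := Metric.closedBall 0 1) fun w hw => ?_).trans_lt
    measure_closedBall_lt_top
  rw [mem_closedBall_zero_iff, pi_norm_le_iff_of_nonneg zero_le_one]
  intro i
  have hle : w i * w i ≤ w ⬝ᵥ w := Finset.single_le_sum (f := fun i => w i * w i)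
    (fun i _ => mul_self_nonneg _) (Finset.mem_univ i)
  exact abs_le_one_iff_mul_self_le_one.2 (hle.trans (hE.dotProduct_action_le hw))

lemma IsRegular.isProbabilityMeasure_unif (hE : E.IsRegular KX KC Kμ KS) :
    IsProbabilityMeasure E.unif :=
  cond_isProbabilityMeasure_of_finite hE.volume_pos.ne' hE.volume_action_lt_top.ne

instance : IsProbabilityMeasure E.labelNoise := by unfold labelNoise; infer_instance

instance : IsProbabilityMeasure E.costNoise := by unfold costNoise; infer_instance

variable (E) in
/-- Joint law of the label noise and the cost noise, which is indexed by the extra point. -/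
def noiseLaw : Measure (Fin d ⊕ Unit → ℝ) := Measure.pi fun _ => gaussianReal 0 (E.σ ^ 2)

lemma map_sumElim_noise :
    (E.labelNoise.prod E.costNoise).map (fun z => Sum.elim z.1 fun _ : Unit => z.2) =
      E.noiseLaw := by
  have hcost : MeasurePreserving (fun h : ℝ => fun _ : Unit => h) E.costNoise
      (Measure.pi fun _ => gaussianReal 0 (E.σ ^ 2)) :=
    (measurePreserving_piUnique fun _ : Unit => gaussianReal 0 (E.σ ^ 2)).symm _
  exact ((measurePreserving_sumPiEquivProdPi_symm fun _ : Fin d ⊕ Unit =>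
    gaussianReal 0 (E.σ ^ 2)).comp ((MeasurePreserving.id E.labelNoise).prod hcost)).map_eq

end Env

namespace Primitives

variable {Ω : Type*} {S : Primitives m d n Ω}

variable (S) in
/-- Label noise and cost noise of individual `i` in round `t`, as one random vector. -/
def noise (t : ℕ) (i : Fin n) (ω : Ω) : Fin d ⊕ Unit → ℝ :=
  Sum.elim (S.e t i ω) fun _ => S.η t i ω

variable (S) in
/-- The σ-algebra of everything except the noises of individual `i` in round `t`. -/
@[reducible] def others (t : ℕ) (i : Fin n) : MeasurableSpace Ω :=
  (⨆ k ∈ ({(t, i)}ᶜ : Set (ℕ × Fin n)), MeasurableSpace.comap (S.all k.1 k.2) inferInstance) ⊔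
    MeasurableSpace.comap (fun ω => (S.x t i ω, S.u t i ω)) inferInstance

lemma comap_all_le_others {s t : ℕ} {i j : Fin n} (h : (s, j) ≠ (t, i)) :
    MeasurableSpace.comap (S.all s j) inferInstance ≤ S.others t i :=
  (le_iSup₂_of_le (f := fun (k : ℕ × Fin n) (_ : k ∈ ({(t, i)}ᶜ : Set (ℕ × Fin n))) =>
    MeasurableSpace.comap (S.all k.1 k.2) inferInstance) (s, j) h le_rfl).trans le_sup_left

lemma comap_comp_all_le {α : Type*} [MeasurableSpace α] {t : ℕ} {i : Fin n}
    {f : (Fin m → ℝ) × (Fin d → ℝ) × (Fin d → ℝ) × ℝ → α} (hf : Measurable f) :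
    MeasurableSpace.comap (fun ω => f (S.all t i ω)) inferInstance ≤
      MeasurableSpace.comap (S.all t i) inferInstance :=
  (hf.comp (comap_measurable (S.all t i))).comap_le

lemma info_le_others (t : ℕ) (i : Fin n) : S.info t ≤ S.others t i := by
  refine sup_le (iSup_le fun s => iSup_le fun j => comap_all_le_others fun h => ?_)
    (iSup_le fun j => ?_)
  · exact s.2.ne (congrArg Prod.fst h)
  · by_cases hj : j = i
    · subst hj
      exact le_sup_right
    · exact (comap_comp_all_le (f := fun z => (z.1, z.2.1)) (by fun_prop)).trans
        (comap_all_le_others fun h => hj (congrArg Prod.snd h))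

lemma comap_all_le_info {s t : ℕ} (h : s < t) (i : Fin n) :
    MeasurableSpace.comap (S.all s i) inferInstance ≤ S.info t :=
  (le_iSup_of_le (f := fun s : Fin t => ⨆ i : Fin n,
    MeasurableSpace.comap (S.all s i) inferInstance) ⟨s, h⟩
      (le_iSup (fun i : Fin n => MeasurableSpace.comap (S.all s i) inferInstance) i)).trans
    le_sup_left

lemma comap_feature_le_info (t : ℕ) (i : Fin n) :
    MeasurableSpace.comap (fun ω => (S.x t i ω, S.u t i ω)) inferInstance ≤ S.info t :=
  (le_iSup (fun i : Fin n =>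
    MeasurableSpace.comap (fun ω => (S.x t i ω, S.u t i ω)) inferInstance) i).trans le_sup_right

lemma info_mono : Monotone S.info := by
  intro s t h
  rcases h.eq_or_lt with rfl | h
  · exact le_rfl
  · exact sup_le (iSup_le fun r => iSup_le fun j => comap_all_le_info (r.2.trans h) j)
      (iSup_le fun j => (comap_comp_all_le (f := fun z => (z.1, z.2.1)) (by fun_prop)).trans
        (comap_all_le_info h j))

lemma measurable_x_info (t : ℕ) (i : Fin n) : Measurable[S.info t] (S.x t i) :=
  (measurable_fst.comp (comap_measurable fun ω => (S.x t i ω, S.u t i ω))).mono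
    (comap_feature_le_info t i) le_rfl

lemma measurable_noise_comap (t : ℕ) (i : Fin n) :
    Measurable[MeasurableSpace.comap (S.all t i) inferInstance] (S.noise t i) := by
  refine (?_ : Measurable fun z : (Fin m → ℝ) × (Fin d → ℝ) × (Fin d → ℝ) × ℝ =>
    (Sum.elim z.2.2.1 fun _ : Unit => z.2.2.2 : Fin d ⊕ Unit → ℝ)).comp
      (comap_measurable (S.all t i))
  refine measurable_pi_iff.2 fun j => ?_
  cases j <;> simp only [Sum.elim_inl, Sum.elim_inr] <;> fun_prop

namespace IsSample

variable [mΩ : MeasurableSpace Ω] {P : Measure Ω} {E : Env m d} {KX KC Kμ KS : ℝ}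
  (hS : S.IsSample P E)
include hS

lemma measurable_x (t : ℕ) (i : Fin n) : Measurable (S.x t i) := (hS.measurable t i).fst

lemma measurable_u (t : ℕ) (i : Fin n) : Measurable (S.u t i) := (hS.measurable t i).snd.fst

lemma measurable_e (t : ℕ) (i : Fin n) : Measurable (S.e t i) := (hS.measurable t i).snd.snd.fst

lemma measurable_eta (t : ℕ) (i : Fin n) : Measurable (S.η t i) :=
  (hS.measurable t i).snd.snd.snd

lemma measurable_noise (t : ℕ) (i : Fin n) : Measurable (S.noise t i) :=
  (measurable_noise_comap t i).mono (hS.measurable t i).comap_le le_rfl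

lemma others_le (t : ℕ) (i : Fin n) : S.others t i ≤ mΩ :=
  sup_le (iSup₂_le fun k _ => (hS.measurable k.1 k.2).comap_le)
    ((hS.measurable_x t i).prodMk (hS.measurable_u t i)).comap_le

lemma info_le (t : ℕ) : S.info t ≤ mΩ :=
  sup_le (iSup_le fun s => iSup_le fun i => (hS.measurable s i).comap_le)
    (iSup_le fun i => ((hS.measurable_x t i).prodMk (hS.measurable_u t i)).comap_le)

lemma map_feature (hE : E.IsRegular KX KC Kμ KS) (t : ℕ) (i : Fin n) :
    P.map (fun ω => (S.x t i ω, S.u t i ω)) = E.Dx.prod E.unif := by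
  have := hE.prob
  have := hE.isProbabilityMeasure_unif
  have hcomp : (fun ω => (S.x t i ω, S.u t i ω)) = Prod.map id Prod.fst ∘ S.all t i := rfl
  rw [hcomp, ← Measure.map_map (by fun_prop) (hS.measurable t i), hS.law,
    ← Measure.map_prod_map _ _ measurable_id measurable_fst]
  simp

lemma map_noises (hE : E.IsRegular KX KC Kμ KS) (t : ℕ) (i : Fin n) :
    P.map (fun ω => (S.e t i ω, S.η t i ω)) = E.labelNoise.prod E.costNoise := by
  have := hE.prob
  have := hE.isProbabilityMeasure_unif
  have hcomp : (fun ω => (S.e t i ω, S.η t i ω)) = (Prod.snd ∘ Prod.snd) ∘ S.all t i := rfl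
  rw [hcomp, ← Measure.map_map (by fun_prop) (hS.measurable t i), hS.law,
    ← Measure.map_map (by fun_prop) (by fun_prop)]
  simp

lemma map_noise (hE : E.IsRegular KX KC Kμ KS) (t : ℕ) (i : Fin n) :
    P.map (S.noise t i) = E.noiseLaw := by
  have hcomp : S.noise t i =
      (fun z : (Fin d → ℝ) × ℝ => (Sum.elim z.1 fun _ : Unit => z.2 : Fin d ⊕ Unit → ℝ)) ∘
        fun ω => (S.e t i ω, S.η t i ω) := rfl
  have helim : Measurable fun z : (Fin d → ℝ) × ℝ =>
      (Sum.elim z.1 fun _ : Unit => z.2 : Fin d ⊕ Unit → ℝ) :=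
    measurable_pi_iff.2 fun j => by
      cases j <;> simp only [Sum.elim_inl, Sum.elim_inr] <;> fun_prop
  rw [hcomp, ← Measure.map_map helim ((hS.measurable_e t i).prodMk (hS.measurable_eta t i)),
    hS.map_noises hE, Env.map_sumElim_noise]

variable [IsProbabilityMeasure P]

lemma indepFun_feature_noises (hE : E.IsRegular KX KC Kμ KS) (t : ℕ) (i : Fin n) :
    IndepFun (fun ω => (S.x t i ω, S.u t i ω)) (fun ω => (S.e t i ω, S.η t i ω)) P := by
  have := hE.prob
  have := hE.isProbabilityMeasure_unif
  have hcomp : (fun ω => ((S.x t i ω, S.u t i ω), S.e t i ω, S.η t i ω)) =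
    MeasurableEquiv.prodAssoc.symm ∘ S.all t i := rfl
  rw [indepFun_iff_map_prod_eq_prod_map_map
    ((hS.measurable_x t i).prodMk (hS.measurable_u t i)).aemeasurable
    ((hS.measurable_e t i).prodMk (hS.measurable_eta t i)).aemeasurable,
    hS.map_feature hE, hS.map_noises hE, hcomp,
    ← Measure.map_map (by fun_prop) (hS.measurable t i), hS.law, ← Measure.prodAssoc_prod,
    MeasurableEquiv.map_symm_map]

lemma indep_others_noises (hE : E.IsRegular KX KC Kμ KS) (t : ℕ) (i : Fin n) :
    Indep (S.others t i)
      (MeasurableSpace.comap (fun ω => (S.e t i ω, S.η t i ω)) inferInstance) P := by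
  refine indep_sup_comap (iSup₂_le fun k _ => (hS.measurable k.1 k.2).comap_le)
    ((hS.measurable_x t i).prodMk (hS.measurable_u t i))
    ((hS.measurable_e t i).prodMk (hS.measurable_eta t i)) ?_ (hS.indepFun_feature_noises hE t i)
  refine indep_of_indep_of_le_right (indep_iSup_of_disjoint (m := fun k : ℕ × Fin n =>
    MeasurableSpace.comap (S.all k.1 k.2) inferInstance)
    (fun k => (hS.measurable k.1 k.2).comap_le) hS.indep (S := {(t, i)}ᶜ) (T := {(t, i)})
    (Set.disjoint_left.2 fun _ h h' => h h')) ?_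
  rw [iSup_singleton]
  exact comap_comp_all_le (f := fun z => ((z.1, z.2.1), z.2.2)) (by fun_prop)

lemma indep_others_noise (hE : E.IsRegular KX KC Kμ KS) (t : ℕ) (i : Fin n) :
    Indep (S.others t i) (MeasurableSpace.comap (S.noise t i) inferInstance) P := by
  refine indep_of_indep_of_le_right (hS.indep_others_noises hE t i) (Measurable.comap_le ?_)
  have hnoises : Measurable[MeasurableSpace.comap (fun ω => (S.e t i ω, S.η t i ω)) inferInstance]
      fun ω => (S.e t i ω, S.η t i ω) := comap_measurable _
  refine @measurable_pi_lambda _ _ _ (_) _ _ fun j => ?_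
  rcases j with j | _
  · exact (measurable_pi_apply j).comp (measurable_fst.comp hnoises)
  · exact measurable_snd.comp hnoises

lemma lintegral_prod_le_one (hE : E.IsRegular KX KC Kμ KS) {β : Type*} [MeasurableSpace β]
    {φ : β → (Fin d ⊕ Unit → ℝ) → ENNReal} (hφ : Measurable (Function.uncurry φ))
    (hφ_le : ∀ q, ∫⁻ y, φ q y ∂E.noiseLaw ≤ 1) {Q : ℕ → Fin n → Ω → β}
    (J : Finset (ℕ × Fin n)) (hQ : ∀ k ∈ J, Measurable[S.info k.1] (Q k.1 k.2)) :
    ∫⁻ ω, ∏ k ∈ J, φ (Q k.1 k.2 ω) (S.noise k.1 k.2 ω) ∂P ≤ 1 := by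
  classical
  revert hQ
  -- We remove a factor of a latest round: given `S.others`, its expectation is at most `1`.
  refine Finset.induction_on_max_value Prod.fst J (by simp) ?_
  rintro ⟨t, i⟩ J hk hmax ih hQ
  have hY : Measurable[S.others t i] fun ω =>
      ∏ k ∈ J, φ (Q k.1 k.2 ω) (S.noise k.1 k.2 ω) := by
    refine Finset.measurable_prod _ fun k hkJ => hφ.comp (Measurable.prodMk ?_ ?_)
    · exact (hQ k (Finset.mem_insert_of_mem hkJ)).mono
        ((info_mono (hmax k hkJ)).trans (info_le_others t i)) le_rfl
    · exact (measurable_noise_comap k.1 k.2).mono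
        (comap_all_le_others fun h => hk (h ▸ hkJ)) le_rfl
  have hQt : Measurable[S.others t i] (Q t i) :=
    (hQ (t, i) (Finset.mem_insert_self _ _)).mono (info_le_others t i) le_rfl
  simp_rw [Finset.prod_insert hk, mul_comm (φ (Q t i _) _)]
  exact (lintegral_mul_le_of_indepFun (hY.mono (hS.others_le t i) le_rfl)
    (hQt.mono (hS.others_le t i) le_rfl) (hS.measurable_noise t i) hφ
    (indep_of_indep_of_le_left (hS.indep_others_noise hE t i) (hY.prodMk hQt).comap_le)
    (by rwa [hS.map_noise hE])).trans
      (ih fun k hkJ => hQ k (Finset.mem_insert_of_mem hkJ))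

end IsSample

end Primitives

end Independence

/-! ### Uniform bounds by discretization -/

section Discretization

lemma exists_finset_net {ι : Type*} [Fintype ι] {Θ : Set (ι → ℝ)} (hΘ : ∀ p ∈ Θ, ∀ j, |p j| ≤ 1)
    {M : ℕ} (hM : 0 < M) :
    ∃ N : Finset (ι → ℝ), ↑N ⊆ Θ ∧ N.card ≤ (2 * M + 1) ^ Fintype.card ι ∧
      ∀ p ∈ Θ, ∃ p' ∈ N, ∀ j, |p j - p' j| ≤ 1 / M := by
  classical
  have hM' : (0 : ℝ) < M := by exact_mod_cast hM
  let cell : (ι → ℝ) → ι → ℤ := fun p j => ⌊M * p j⌋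
  let cells : Finset (ι → ℤ) := Fintype.piFinset fun _ => Finset.Icc (-(M : ℤ)) M
  have hcell : ∀ p ∈ Θ, cell p ∈ cells := fun p hp => Fintype.mem_piFinset.2 fun j => by
    obtain ⟨hlower, hupper⟩ := abs_le.1 (hΘ p hp j)
    rw [Finset.mem_Icc, Int.le_floor, ← Int.lt_add_one_iff, Int.floor_lt]
    push_cast
    constructor <;> nlinarith
  obtain ⟨N, hNΘ, hN⟩ := Set.exists_subset_bijOn Θ cell
  have hfin : N.Finite := .of_injOn (fun p hp => hcell p (hNΘ hp)) hN.injOn cells.finite_toSet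
  refine ⟨hfin.toFinset, by simpa using hNΘ, ?_, fun p hp => ?_⟩
  · refine (Finset.card_le_card_of_injOn cell (fun p hp => hcell p (hNΘ (hfin.mem_toFinset.1 hp)))
      (by simpa using hN.injOn)).trans (le_of_eq ?_)
    rw [Fintype.card_piFinset, Finset.prod_const, Int.card_Icc, Finset.card_univ]
    congr 1
    lia
  · obtain ⟨p', hp', heq⟩ := hN.surjOn ⟨p, hp, rfl⟩
    refine ⟨p', hfin.mem_toFinset.2 hp', fun j => ?_⟩
    have hdist := Int.abs_sub_lt_one_of_floor_eq_floor (congrFun heq j)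
    rw [← mul_sub, abs_mul, abs_of_pos hM', abs_sub_comm] at hdist
    rw [le_div_iff₀ hM', mul_comm]
    exact hdist.le

lemma exists_integrable_forall_le {α Ω : Type*} [MeasurableSpace Ω] {P : Measure Ω}
    [IsProbabilityMeasure P] {N : Finset α} {f : α → Ω → ℝ} (hf : ∀ p ∈ N, Measurable (f p))
    (hexp : ∀ p ∈ N, ∫⁻ ω, ENNReal.ofReal (Real.exp (f p ω)) ∂P ≤ 1) {K : ℝ} (hK : 0 < K)
    (hN : N.card ≤ K) :
    ∃ G : Ω → ℝ, Integrable G P ∧ ∫ ω, G ω ∂P ≤ 1 + Real.log K ∧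
      ∀ ω, ∀ p ∈ N, f p ω ≤ G ω := by
  have hint : ∀ p ∈ N, Integrable (fun ω => Real.exp (f p ω)) P := fun p hp => by
    refine ⟨(hf p hp).exp.aestronglyMeasurable, ?_⟩
    rw [hasFiniteIntegral_iff_ofReal (.of_forall fun ω => Real.exp_nonneg _)]
    exact (hexp p hp).trans_lt ENNReal.one_lt_top
  have hint_le : ∀ p ∈ N, ∫ ω, Real.exp (f p ω) ∂P ≤ 1 := fun p hp => by
    rw [integral_eq_lintegral_of_nonneg_ae (.of_forall fun ω => Real.exp_nonneg _) (hint p hp).1]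
    exact ENNReal.toReal_le_of_le_ofReal zero_le_one (by simpa using hexp p hp)
  have hsum : Integrable (fun ω => K⁻¹ * ∑ p ∈ N, Real.exp (f p ω)) P :=
    (integrable_finsetSum _ hint).const_mul _
  refine ⟨fun ω => K⁻¹ * ∑ p ∈ N, Real.exp (f p ω) + Real.log K,
    hsum.add (integrable_const _), ?_, fun ω p hp => ?_⟩
  · have hle : ∑ p ∈ N, ∫ ω, Real.exp (f p ω) ∂P ≤ K :=
      (Finset.sum_le_card_nsmul _ _ _ hint_le).trans (by simpa using hN)
    rw [integral_add hsum (integrable_const _), integral_const_mul, integral_finsetSum _ hint]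
    simp only [integral_const, probReal_univ, one_smul]
    gcongr
    rwa [inv_mul_le_iff₀ hK, mul_one]
  · have hsingle : Real.exp (f p ω) ≤ ∑ p ∈ N, Real.exp (f p ω) :=
      Finset.single_le_sum (f := fun p => Real.exp (f p ω)) (fun _ _ => Real.exp_nonneg _) hp
    have htangent := Real.add_one_le_exp (f p ω - Real.log K)
    rw [Real.exp_sub, Real.exp_log hK, div_eq_inv_mul] at htangent
    linarith [mul_le_mul_of_nonneg_left hsingle (inv_nonneg.2 hK.le)]

lemma exists_integrable_forall_mem_le {ι Ω : Type*} [Fintype ι] [MeasurableSpace Ω]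
    {P : Measure Ω} [IsProbabilityMeasure P] {Θ : Set (ι → ℝ)} (hΘ : ∀ p ∈ Θ, ∀ j, |p j| ≤ 1)
    {f : (ι → ℝ) → Ω → ℝ} (hf : ∀ p ∈ Θ, Measurable (f p))
    (hexp : ∀ p ∈ Θ, ∫⁻ ω, ENNReal.ofReal (Real.exp (f p ω)) ∂P ≤ 1) {M : ℕ} (hM : 0 < M)
    {H : Ω → ℝ} (hH : Integrable H P)
    (hLip : ∀ᵐ ω ∂P, ∀ p ∈ Θ, ∀ p' ∈ Θ, (∀ j, |p j - p' j| ≤ 1 / M) → f p ω ≤ f p' ω + H ω) :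
    ∃ G : Ω → ℝ, Integrable G P ∧
      ∫ ω, G ω ∂P ≤ 1 + Fintype.card ι * Real.log (2 * M + 1) + ∫ ω, H ω ∂P ∧
      ∀ᵐ ω ∂P, ∀ p ∈ Θ, f p ω ≤ G ω := by
  obtain ⟨N, hNΘ, hcard, hnet⟩ := exists_finset_net hΘ hM
  obtain ⟨G, hG, hGint, hGle⟩ := exists_integrable_forall_le (fun p hp => hf p (hNΘ hp))
    (fun p hp => hexp p (hNΘ hp)) (K := (2 * M + 1) ^ Fintype.card ι) (by positivity)
    (by exact_mod_cast hcard)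
  refine ⟨fun ω => G ω + H ω, hG.add hH, ?_, ?_⟩
  · rw [integral_add hG hH]
    rw [Real.log_pow] at hGint
    gcongr
  · filter_upwards [hLip] with ω hω p hp
    obtain ⟨p', hp', hdist⟩ := hnet p hp
    exact (hω p hp p' (hNΘ hp') hdist).trans (by gcongr; exact hGle ω p' hp')

end Discretization

/-! ### A uniform bound for the noise -/

section NoiseBound

lemma dotProduct_self_nonneg {ι : Type*} [Fintype ι] (v : ι → ℝ) : 0 ≤ v ⬝ᵥ v := by
  simpa using dotProduct_star_self_nonneg v

lemma abs_le_of_dotProduct_self_le {ι : Type*} [Fintype ι] {v : ι → ℝ} {r : ℝ} (hr : 0 ≤ r)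
    (h : v ⬝ᵥ v ≤ r ^ 2) (j : ι) : |v j| ≤ r := by
  refine abs_le_of_sq_le_sq (le_trans ?_ h) hr
  rw [sq]
  exact Finset.single_le_sum (f := fun i => v i * v i) (fun i _ => mul_self_nonneg _)
    (Finset.mem_univ j)

lemma abs_dotProduct_le {ι : Type*} [Fintype ι] {p z : ι → ℝ} {a : ℝ} (hp : ∀ j, |p j| ≤ a) :
    |p ⬝ᵥ z| ≤ a * ∑ j, |z j| := by
  rw [Finset.mul_sum]
  refine (Finset.abs_sum_le_sum_abs _ _).trans (Finset.sum_le_sum fun j _ => ?_)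
  rw [abs_mul]
  exact mul_le_mul_of_nonneg_right (hp j) (abs_nonneg _)

@[fun_prop]
lemma measurable_dotProduct {α ι : Type*} [Fintype ι] [MeasurableSpace α] {f g : α → ι → ℝ}
    (hf : Measurable f) (hg : Measurable g) : Measurable fun a => f a ⬝ᵥ g a := by
  unfold dotProduct
  fun_prop

/-- The linear functional `(v ⬝ ξ) (p ⬝ z)` of the noise `ξ` with regressor `z`, minus a quadratic
compensator that makes its exponential a supermartingale increment when `|v| ≤ 1` and `ξ` is a
centered Gaussian vector of variance at most `τ`. -/
def compensated {ι κ : Type*} [Fintype ι] [Fintype κ] (τ : ℝ) (p : ι → ℝ) (v : κ → ℝ) (z : ι → ℝ)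
    (ξ : κ → ℝ) : ℝ :=
  (v ⬝ᵥ ξ) * (p ⬝ᵥ z) - τ / 2 * (p ⬝ᵥ z) ^ 2

section

variable {ι κ : Type*} [Fintype ι] [Fintype κ]

lemma compensated_le_add {τ : ℝ} (hτ : 0 ≤ τ) {p p' : ι → ℝ} {v v' : κ → ℝ}
    (hp : ∀ j, |p j| ≤ 1) (hp' : ∀ j, |p' j| ≤ 1) (hv' : ∀ j, |v' j| ≤ 1) {δ : ℝ}
    (hδ : 0 ≤ δ) (hpp' : ∀ j, |p j - p' j| ≤ δ) (hvv' : ∀ j, |v j - v' j| ≤ δ) {z : ι → ℝ}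
    {b : ℝ} (hz : ∑ j, |z j| ≤ b) (ξ : κ → ℝ) :
    compensated τ p v z ξ ≤
      compensated τ p' v' z ξ + δ * b * (2 * ∑ j, |ξ j| + τ * b) := by
  have hdot {q : ι → ℝ} (hq : ∀ j, |q j| ≤ 1) : |q ⬝ᵥ z| ≤ b :=
    (abs_dotProduct_le hq).trans ((one_mul _).trans_le hz)
  have hb : 0 ≤ b := (abs_nonneg _).trans (hdot hp)
  have hvξ : |(v - v') ⬝ᵥ ξ| ≤ δ * ∑ j, |ξ j| := abs_dotProduct_le hvv'
  have hpz : |(p - p') ⬝ᵥ z| ≤ δ * b :=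
    (abs_dotProduct_le hpp').trans (mul_le_mul_of_nonneg_left hz hδ)
  have hv'ξ : |v' ⬝ᵥ ξ| ≤ ∑ j, |ξ j| := (abs_dotProduct_le hv').trans_eq (one_mul _)
  have hfst : ((v - v') ⬝ᵥ ξ) * (p ⬝ᵥ z) ≤ (δ * ∑ j, |ξ j|) * b :=
    (le_abs_self _).trans ((abs_mul _ _).trans_le (by gcongr; exact hdot hp))
  have hsnd : (v' ⬝ᵥ ξ) * ((p - p') ⬝ᵥ z) ≤ (∑ j, |ξ j|) * (δ * b) :=
    (le_abs_self _).trans ((abs_mul _ _).trans_le (by gcongr))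
  have hquad : -(((p - p') ⬝ᵥ z) * (p ⬝ᵥ z + p' ⬝ᵥ z)) ≤ (δ * b) * (b + b) :=
    (neg_le_abs _).trans ((abs_mul _ _).trans_le (by
      gcongr
      exact (abs_add_le _ _).trans (add_le_add (hdot hp) (hdot hp'))))
  rw [sub_dotProduct] at hfst hsnd hquad
  unfold compensated
  linear_combination hfst + hsnd + τ / 2 * hquad

lemma lintegral_exp_dotProduct_pi_gaussianReal (s : ℝ≥0) (q : κ → ℝ) :
    ∫⁻ y, ENNReal.ofReal (Real.exp (q ⬝ᵥ y)) ∂(Measure.pi fun _ => gaussianReal 0 s) =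
      ENNReal.ofReal (Real.exp (s / 2 * (q ⬝ᵥ q))) := by
  have hprod (y : κ → ℝ) : Real.exp (q ⬝ᵥ y) = ∏ j, Real.exp (q j * y j) := Real.exp_sum _ _
  have hmgf (c : ℝ) : ∫ x, Real.exp (c * x) ∂(gaussianReal 0 s) = Real.exp (s / 2 * c ^ 2) := by
    have h := congrFun (mgf_id_gaussianReal (μ := 0) (v := s)) c
    simp only [mgf, id] at h
    rw [h]
    ring_nf
  have hint : Integrable (fun y : κ → ℝ => ∏ j, Real.exp (q j * y j))
      (Measure.pi fun _ => gaussianReal 0 s) :=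
    Integrable.fintype_prod fun j => integrable_exp_mul_gaussianReal (q j)
  simp_rw [hprod]
  rw [← ofReal_integral_eq_lintegral_ofReal hint (.of_forall fun y => by positivity),
    integral_fintype_prod_eq_prod (fun j x => Real.exp (q j * x))]
  simp_rw [hmgf, ← Real.exp_sum, ← Finset.mul_sum, sq]
  rfl

lemma lintegral_exp_compensated_le_one {s : ℝ≥0} {τ : ℝ} (hτ : s ≤ τ) {v : κ → ℝ}
    (hv : v ⬝ᵥ v ≤ 1) (p z : ι → ℝ) :
    ∫⁻ y, ENNReal.ofReal (Real.exp (compensated τ p v z y))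
      ∂(Measure.pi fun _ => gaussianReal 0 s) ≤ 1 := by
  have hsplit (y : κ → ℝ) : ENNReal.ofReal (Real.exp (compensated τ p v z y)) =
      ENNReal.ofReal (Real.exp (-(τ / 2 * (p ⬝ᵥ z) ^ 2))) *
        ENNReal.ofReal (Real.exp (((p ⬝ᵥ z) • v) ⬝ᵥ y)) := by
    rw [← ENNReal.ofReal_mul (Real.exp_nonneg _), ← Real.exp_add, smul_dotProduct, smul_eq_mul,
      compensated]
    ring_nf
  simp_rw [hsplit]
  rw [lintegral_const_mul _ (by fun_prop), lintegral_exp_dotProduct_pi_gaussianReal,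
    ← ENNReal.ofReal_mul (Real.exp_nonneg _), ← Real.exp_add, ENNReal.ofReal_le_one,
    Real.exp_le_one_iff, smul_dotProduct, dotProduct_smul, smul_eq_mul, smul_eq_mul]
  have hle : s * (v ⬝ᵥ v) ≤ τ := (mul_le_of_le_one_right s.2 hv).trans hτ
  linear_combination (p ⬝ᵥ z) ^ 2 / 2 * hle

end

variable {m d n : ℕ} {Ω : Type*} [MeasurableSpace Ω] {S : Primitives m d n Ω} {P : Measure Ω}
  {E : Env m d} {KX KC Kμ KS : ℝ}

/-- An upper bound for the noise variance that is also at least `1`. -/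
def Env.tau (E : Env m d) : ℝ := (E.σ : ℝ) ^ 2 + 1

lemma Env.one_le_tau (E : Env m d) : 1 ≤ E.tau := le_add_of_nonneg_left (sq_nonneg _)

/-- Bound for the expected supremum, over directions in the unit balls, of the compensated sum of at
most `N` noises with regressors of dimension `D` and norm at most `B`. The logarithm comes from a
grid of resolution `1 / (D ^ 2 * N)` and the last summand from the discretization error. -/
def noiseBudget (τ B : ℝ) (D N : ℕ) : ℝ :=
  1 + 3 * D * Real.log (2 * (D ^ 2 * N) + 1) + τ * B * (4 + B)

lemma discretization_error_le {D d' N J B τ : ℝ} (hD : 0 < D) (hd : 1 ≤ d') (hdD : d' ≤ D)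
    (hN : 0 < N) (hJ : J ≤ N) (hB : 0 ≤ B) (hτ : 0 ≤ τ) :
    J * (1 / (D ^ 2 * N) * (D * B) * (2 * ((d' + 1) * τ) + τ * (D * B))) ≤ τ * B * (4 + B) :=
  calc J * (1 / (D ^ 2 * N) * (D * B) * (2 * ((d' + 1) * τ) + τ * (D * B)))
      ≤ N * (1 / (D ^ 2 * N) * (D * B) * (2 * ((D + D) * τ) + τ * (D * B))) := by
        gcongr; linarith
    _ = τ * B * (4 + B) := by field_simp; ring

namespace Primitives.IsSample

lemma measurePreserving_noise_apply (hS : S.IsSample P E) (hE : E.IsRegular KX KC Kμ KS) (t : ℕ)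
    (i : Fin n) (j : Fin d ⊕ Unit) :
    MeasurePreserving (fun ω => S.noise t i ω j) P (gaussianReal 0 (E.σ ^ 2)) :=
  (measurePreserving_eval (fun _ : Fin d ⊕ Unit => gaussianReal 0 (E.σ ^ 2)) j).comp
    ⟨hS.measurable_noise t i, hS.map_noise hE t i⟩

lemma integrable_noise_apply (hS : S.IsSample P E) (hE : E.IsRegular KX KC Kμ KS) (t : ℕ)
    (i : Fin n) (j : Fin d ⊕ Unit) : Integrable (fun ω => S.noise t i ω j) P :=
  ((hS.measurePreserving_noise_apply hE t i j).integrable_comp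
    aestronglyMeasurable_id).2 (memLp_id_gaussianReal 1 |>.integrable le_rfl)

lemma integral_noise_apply (hS : S.IsSample P E) (hE : E.IsRegular KX KC Kμ KS) (t : ℕ)
    (i : Fin n) (j : Fin d ⊕ Unit) : ∫ ω, S.noise t i ω j ∂P = 0 := by
  have hmp := hS.measurePreserving_noise_apply hE t i j
  rw [← integral_map hmp.measurable.aemeasurable (f := fun x => x) aestronglyMeasurable_id,
    hmp.map_eq, integral_id_gaussianReal]

lemma integral_abs_noise_apply_le (hS : S.IsSample P E) (hE : E.IsRegular KX KC Kμ KS) (t : ℕ)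
    (i : Fin n) (j : Fin d ⊕ Unit) : ∫ ω, |S.noise t i ω j| ∂P ≤ E.tau := by
  have hmp := hS.measurePreserving_noise_apply hE t i j
  have hsq : Integrable (fun x : ℝ => x ^ 2) (gaussianReal 0 (E.σ ^ 2)) :=
    (memLp_id_gaussianReal 2).integrable_sq
  rw [← integral_map hmp.measurable.aemeasurable (f := fun x => |x|)
    continuous_abs.aestronglyMeasurable, hmp.map_eq]
  calc ∫ x, |x| ∂gaussianReal 0 (E.σ ^ 2)
      ≤ ∫ x, x ^ 2 + 1 ∂gaussianReal 0 (E.σ ^ 2) :=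
        integral_mono (memLp_id_gaussianReal 1 |>.integrable le_rfl).abs
          (hsq.add (integrable_const _)) fun x => by
            nlinarith [sq_abs x, sq_nonneg (|x| - 1), abs_nonneg x]
    _ = Var[id; gaussianReal 0 (E.σ ^ 2)] + 1 := by
        rw [variance_of_integral_eq_zero aemeasurable_id (by simp [integral_id_gaussianReal]),
          integral_add hsq (integrable_const _)]
        simp
    _ = E.tau := by rw [variance_id_gaussianReal]; simp [Env.tau]

variable [IsProbabilityMeasure P] {ι : Type*} [Fintype ι] {z : ℕ → Fin n → Ω → ι → ℝ}
  {J : Finset (ℕ × Fin n)}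

lemma lintegral_exp_sum_compensated_le_one (hS : S.IsSample P E) (hE : E.IsRegular KX KC Kμ KS)
    (hz : ∀ k ∈ J, Measurable[S.info k.1] (z k.1 k.2)) {v : Fin d ⊕ Unit → ℝ} (hv : v ⬝ᵥ v ≤ 1)
    (p : ι → ℝ) :
    ∫⁻ ω, ENNReal.ofReal (Real.exp (∑ k ∈ J,
      compensated E.tau p v (z k.1 k.2 ω) (S.noise k.1 k.2 ω))) ∂P ≤ 1 := by
  have hτ : ((E.σ ^ 2 : ℝ≥0) : ℝ) ≤ E.tau := by simp [Env.tau]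
  simp_rw [Real.exp_sum, ENNReal.ofReal_prod_of_nonneg fun _ _ => Real.exp_nonneg _]
  refine hS.lintegral_prod_le_one hE
    (φ := fun z y => ENNReal.ofReal (Real.exp (compensated E.tau p v z y))) ?_
    (lintegral_exp_compensated_le_one hτ hv p) J hz
  unfold compensated Function.uncurry
  fun_prop

omit [IsProbabilityMeasure P] in
lemma integral_sum_abs_noise_le (hS : S.IsSample P E) (hE : E.IsRegular KX KC Kμ KS) (t : ℕ)
    (i : Fin n) : ∫ ω, ∑ j, |S.noise t i ω j| ∂P ≤ (d + 1) * E.tau := by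
  rw [integral_finsetSum _ fun j _ => (hS.integrable_noise_apply hE t i j).abs]
  simpa using Finset.sum_le_card_nsmul Finset.univ _ _
    fun j _ => hS.integral_abs_noise_apply_le hE t i j

lemma exists_discretization_error (hS : S.IsSample P E) (hE : E.IsRegular KX KC Kμ KS)
    {B : ℝ} (hB : 0 ≤ B) (hzB : ∀ᵐ ω ∂P, ∀ k ∈ J, z k.1 k.2 ω ⬝ᵥ z k.1 k.2 ω ≤ B ^ 2) {δ : ℝ}
    (hδ : 0 ≤ δ) :
    ∃ H : Ω → ℝ, Integrable H P ∧
      ∫ ω, H ω ∂P ≤ J.card * (δ * (Fintype.card ι * B) *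
        (2 * ((d + 1) * E.tau) + E.tau * (Fintype.card ι * B))) ∧
      ∀ᵐ ω ∂P, ∀ p p' : ι → ℝ, ∀ v v' : Fin d ⊕ Unit → ℝ, p ⬝ᵥ p ≤ 1 → p' ⬝ᵥ p' ≤ 1 →
        v' ⬝ᵥ v' ≤ 1 → (∀ j, |p j - p' j| ≤ δ) → (∀ j, |v j - v' j| ≤ δ) →
        ∑ k ∈ J, compensated E.tau p v (z k.1 k.2 ω) (S.noise k.1 k.2 ω) ≤
          ∑ k ∈ J, compensated E.tau p' v' (z k.1 k.2 ω) (S.noise k.1 k.2 ω) + H ω := by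
  have hτ : 0 ≤ E.tau := zero_le_one.trans E.one_le_tau
  set b : ℝ := Fintype.card ι * B
  have hsum_int (k : ℕ × Fin n) : Integrable (fun ω => ∑ j, |S.noise k.1 k.2 ω j|) P :=
    integrable_finsetSum _ fun j _ => (hS.integrable_noise_apply hE k.1 k.2 j).abs
  have hint (k : ℕ × Fin n) : Integrable
      (fun ω => δ * b * (2 * ∑ j, |S.noise k.1 k.2 ω j| + E.tau * b)) P :=
    (((hsum_int k).const_mul 2).add (integrable_const _)).const_mul _
  refine ⟨fun ω => ∑ k ∈ J, δ * b * (2 * ∑ j, |S.noise k.1 k.2 ω j| + E.tau * b),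
    integrable_finsetSum _ fun k _ => hint k, ?_, ?_⟩
  · rw [integral_finsetSum _ fun k _ => hint k, ← nsmul_eq_mul]
    refine Finset.sum_le_card_nsmul _ _ _ fun k _ => ?_
    rw [integral_const_mul, integral_add ((hsum_int k).const_mul 2) (integrable_const _),
      integral_const_mul]
    simp only [integral_const, probReal_univ, one_smul]
    gcongr
    exact hS.integral_sum_abs_noise_le hE k.1 k.2
  · filter_upwards [hzB] with ω hω p p' v v' hp hp' hv' hpp' hvv'
    rw [← Finset.sum_add_distrib]
    refine Finset.sum_le_sum fun k hk => ?_
    have hz : ∑ j, |z k.1 k.2 ω j| ≤ b := by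
      simpa using Finset.sum_le_card_nsmul Finset.univ _ B
        fun j _ => abs_le_of_dotProduct_self_le hB (hω k hk) j
    exact compensated_le_add hτ (abs_le_of_dotProduct_self_le zero_le_one (by simpa using hp))
      (abs_le_of_dotProduct_self_le zero_le_one (by simpa using hp'))
      (abs_le_of_dotProduct_self_le zero_le_one (by simpa using hv')) hδ hpp' hvv' hz _

lemma exists_noise_bound (hS : S.IsSample P E) (hE : E.IsRegular KX KC Kμ KS) (hd : 1 ≤ d)
    (hdι : d ≤ Fintype.card ι) (hz : ∀ k ∈ J, Measurable[S.info k.1] (z k.1 k.2)) {B : ℝ}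
    (hB : 0 ≤ B) (hzB : ∀ᵐ ω ∂P, ∀ k ∈ J, z k.1 k.2 ω ⬝ᵥ z k.1 k.2 ω ≤ B ^ 2) {N : ℕ}
    (hN : 0 < N) (hJ : J.card ≤ N) :
    ∃ G : Ω → ℝ, Integrable G P ∧
      ∫ ω, G ω ∂P ≤ noiseBudget E.tau B (Fintype.card ι) N ∧
      ∀ᵐ ω ∂P, ∀ (p : ι → ℝ) (v : Fin d ⊕ Unit → ℝ), p ⬝ᵥ p ≤ 1 → v ⬝ᵥ v ≤ 1 →
        ∑ k ∈ J, compensated E.tau p v (z k.1 k.2 ω) (S.noise k.1 k.2 ω) ≤ G ω := by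
  set D := Fintype.card ι
  have hD : 0 < D := hd.trans hdι
  have hM : 0 < D ^ 2 * N := by positivity
  obtain ⟨H, hH, hHint, hHle⟩ := hS.exists_discretization_error hE hB hzB
    (δ := 1 / (D ^ 2 * N : ℕ)) (by positivity)
  let Θ : Set (ι ⊕ (Fin d ⊕ Unit) → ℝ) := {θ | (θ ∘ Sum.inl) ⬝ᵥ (θ ∘ Sum.inl) ≤ 1 ∧
    (θ ∘ Sum.inr) ⬝ᵥ (θ ∘ Sum.inr) ≤ 1}
  have hbox : ∀ θ ∈ Θ, ∀ j, |θ j| ≤ 1 := by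
    rintro θ ⟨hp, hv⟩ (j | j)
    · exact abs_le_of_dotProduct_self_le zero_le_one (by simpa using hp) j
    · exact abs_le_of_dotProduct_self_le zero_le_one (by simpa using hv) j
  obtain ⟨G, hG, hGint, hGle⟩ := exists_integrable_forall_mem_le hbox (P := P)
    (f := fun θ ω => ∑ k ∈ J, compensated E.tau (θ ∘ Sum.inl) (θ ∘ Sum.inr) (z k.1 k.2 ω)
      (S.noise k.1 k.2 ω))
    (fun θ _ => Finset.measurable_sum _ fun k hk => by
      have hzk := (hz k hk).mono (hS.info_le k.1) le_rfl
      have hξ := hS.measurable_noise k.1 k.2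
      unfold compensated
      fun_prop)
    (fun θ hθ => hS.lintegral_exp_sum_compensated_le_one hE hz hθ.2 _) hM hH
    (by
      filter_upwards [hHle] with ω hω θ hθ θ' hθ' hdist
      exact hω _ _ _ _ hθ.1 hθ'.1 hθ'.2 (fun j => hdist _) fun j => hdist _)
  refine ⟨G, hG, hGint.trans ?_, ?_⟩
  · have hcard : (Fintype.card (ι ⊕ (Fin d ⊕ Unit)) : ℝ) ≤ 3 * D := by
      simp only [Fintype.card_sum, Fintype.card_fin, Fintype.card_unit]
      exact_mod_cast (by lia : D + (d + 1) ≤ 3 * D)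
    have hH_le := hHint.trans (by
      simpa using discretization_error_le (τ := E.tau) (B := B) (J := J.card) (N := N)
        (by positivity) (by exact_mod_cast hd) (by exact_mod_cast hdι) (by positivity)
        (by exact_mod_cast hJ) hB (zero_le_one.trans E.one_le_tau))
    unfold noiseBudget
    push_cast
    gcongr
    exact Real.log_nonneg (by linarith [show (0 : ℝ) ≤ 2 * (D ^ 2 * N) by positivity])
  · filter_upwards [hGle] with ω hω p v hp hv
    simpa [Sum.elim_comp_inl, Sum.elim_comp_inr] using
      hω (Sum.elim p v) ⟨by simpa using hp, by simpa using hv⟩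

end Primitives.IsSample

end NoiseBound

/-! ### Errors of the least squares and the ridge estimates -/

section EstimationErrors

lemma sq_dotProduct_le {ι : Type*} [Fintype ι] (p z : ι → ℝ) :
    (p ⬝ᵥ z) ^ 2 ≤ (p ⬝ᵥ p) * (z ⬝ᵥ z) := by
  simpa [dotProduct, sq] using Finset.sum_mul_sq_le_sq_mul_sq Finset.univ p z

lemma abs_dotProduct_le_sqrt_mul_sqrt {ι : Type*} [Fintype ι] (p z : ι → ℝ) :
    |p ⬝ᵥ z| ≤ √(p ⬝ᵥ p) * √(z ⬝ᵥ z) := by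
  rw [← Real.sqrt_mul (dotProduct_self_nonneg p)]
  exact Real.abs_le_sqrt (sq_dotProduct_le p z)

lemma le_add_of_forall_scale {τ ε r L G N : ℝ} (hτ : 1 ≤ τ) (hε : 0 < ε) (hε1 : ε ≤ 1)
    (hN : 0 < N) (hL : N * r ^ 2 ≤ L)
    (h : ∀ a, 0 ≤ a → a * r ≤ 1 → a * L ≤ G + τ / 2 * a ^ 2 * L) :
    r ≤ ε + 2 * τ * G / (ε * N) := by
  have : 0 < τ := zero_lt_one.trans_le hτ
  have hG : 0 ≤ G := by simpa using h 0 le_rfl (by simp)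
  rcases le_or_gt r ε with hr | hr
  · exact hr.trans (le_add_of_nonneg_right (by positivity))
  -- The scale `a = ε / (τ r)` makes the quadratic term at most half of `a L`.
  have hr0 : 0 < r := hε.trans hr
  have hL0 : 0 ≤ L := le_trans (by positivity) hL
  have hscale := h (ε / (τ * r)) (by positivity) (by
    rw [div_mul_eq_mul_div, div_le_one (by positivity)]
    nlinarith)
  have hquad : τ / 2 * (ε / (τ * r)) ^ 2 * L ≤ ε / (τ * r) * L / 2 := by
    have heq : τ / 2 * (ε / (τ * r)) ^ 2 * L = (ε / (τ * r) * L / 2) * (ε / r) := by field_simp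
    rw [heq]
    exact mul_le_of_le_one_right (by positivity) ((div_le_one hr0).2 hr.le)
  have hle : ε * L ≤ 2 * τ * G * r := by
    have : ε / (τ * r) * L ≤ 2 * G := by linarith
    rw [div_mul_eq_mul_div, div_le_iff₀ (by positivity)] at this
    linarith
  have hr_le : r ≤ 2 * τ * G / (ε * N) := by
    rw [le_div_iff₀ (by positivity)]
    refine le_of_mul_le_mul_right ?_ hr0
    calc r * (ε * N) * r = ε * (N * r ^ 2) := by ring
      _ ≤ ε * L := by gcongr
      _ ≤ 2 * τ * G * r := hle
  linarith

lemma sqrt_dotProduct_self_le_of_compensated_le {α ι κ : Type*} [Fintype ι] [Fintype κ]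
    {J : Finset α} {z : α → ι → ℝ} {ξ : α → κ → ℝ} {v : κ → ℝ} {p : ι → ℝ} {τ ε G g L N : ℝ}
    (hτ : 1 ≤ τ) (hε : 0 < ε) (hε1 : ε ≤ 1) (hN : 0 < N) (hL : N * (p ⬝ᵥ p) ≤ L)
    (hfit : ∀ a, a * L ≤
      a * ∑ k ∈ J, (v ⬝ᵥ ξ k) * (p ⬝ᵥ z k) + τ / 2 * a ^ 2 * (L - ∑ k ∈ J, (p ⬝ᵥ z k) ^ 2) + g)
    (hnoise : ∀ q : ι → ℝ, q ⬝ᵥ q ≤ 1 → ∑ k ∈ J, compensated τ q v (z k) (ξ k) ≤ G) :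
    √(p ⬝ᵥ p) ≤ ε + 2 * τ * (G + g) / (ε * N) := by
  refine le_add_of_forall_scale hτ hε hε1 hN (L := L)
    (by rwa [Real.sq_sqrt (dotProduct_self_nonneg p)]) fun a ha har => ?_
  have hap : (a • p) ⬝ᵥ (a • p) ≤ 1 := by
    calc (a • p) ⬝ᵥ (a • p) = (a * √(p ⬝ᵥ p)) ^ 2 := by
          rw [mul_pow, Real.sq_sqrt (dotProduct_self_nonneg p)]
          simp only [smul_dotProduct, dotProduct_smul, smul_eq_mul, sq, mul_assoc]
      _ ≤ 1 := pow_le_one₀ (by positivity) har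
  have hcomp : ∑ k ∈ J, compensated τ (a • p) v (z k) (ξ k) =
      a * ∑ k ∈ J, (v ⬝ᵥ ξ k) * (p ⬝ᵥ z k) - τ / 2 * a ^ 2 * ∑ k ∈ J, (p ⬝ᵥ z k) ^ 2 := by
    rw [Finset.mul_sum, Finset.mul_sum, ← Finset.sum_sub_distrib]
    refine Finset.sum_congr rfl fun k _ => ?_
    simp only [compensated, smul_dotProduct, smul_eq_mul]
    ring
  linarith [hfit a, hnoise _ hap]

lemma sum_residual_mul_eq_zero {α ι κ : Type*} [Fintype ι] [Fintype κ] {J : Finset α}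
    {y : α → κ → ℝ} {z : α → ι → ℝ} {M : Matrix κ ι ℝ}
    (hM : ∀ M' : Matrix κ ι ℝ, ∑ k ∈ J, (y k - M *ᵥ z k) ⬝ᵥ (y k - M *ᵥ z k) ≤
      ∑ k ∈ J, (y k - M' *ᵥ z k) ⬝ᵥ (y k - M' *ᵥ z k)) (v : κ → ℝ) (p : ι → ℝ) :
    ∑ k ∈ J, (v ⬝ᵥ (y k - M *ᵥ z k)) * (p ⬝ᵥ z k) = 0 := by
  -- Perturbing `M` in the direction `v pᵀ` changes the loss by a nonnegative quadratic polynomial.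
  have hexpand (r : ℝ) (k : α) :
      (y k - (M + r • Matrix.vecMulVec v p) *ᵥ z k) ⬝ᵥ
          (y k - (M + r • Matrix.vecMulVec v p) *ᵥ z k) =
        (y k - M *ᵥ z k) ⬝ᵥ (y k - M *ᵥ z k) - 2 * r * ((v ⬝ᵥ (y k - M *ᵥ z k)) * (p ⬝ᵥ z k)) +
          r ^ 2 * ((v ⬝ᵥ v) * (p ⬝ᵥ z k) ^ 2) := by
    simp only [Matrix.add_mulVec, Matrix.smul_mulVec, Matrix.vecMulVec_mulVec, op_smul_eq_smul,
      ← sub_sub]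
    generalize y k - M *ᵥ z k = R
    simp only [sub_dotProduct, dotProduct_sub, smul_dotProduct, dotProduct_smul, smul_eq_mul,
      dotProduct_comm R v]
    ring
  have hdiscrim := discrim_le_zero (a := ∑ k ∈ J, (v ⬝ᵥ v) * (p ⬝ᵥ z k) ^ 2)
    (b := -2 * ∑ k ∈ J, (v ⬝ᵥ (y k - M *ᵥ z k)) * (p ⬝ᵥ z k)) (c := 0) fun r => by
      have hr := hM (M + r • Matrix.vecMulVec v p)
      simp only [hexpand, Finset.sum_add_distrib, Finset.sum_sub_distrib, ← Finset.mul_sum] at hr ⊢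
      linarith
  rw [discrim] at hdiscrim
  exact pow_eq_zero_iff two_ne_zero |>.1 (le_antisymm (by linarith) (sq_nonneg _))

variable {m d n : ℕ} {Ω : Type*} {S : Primitives m d n Ω} {E : Env m d} {KX KC Kμ KS : ℝ}
  {w : ℕ → Fin n → Ω → (Fin d → ℝ)} {b : Fin d → Fin d → ℝ} {γ : ℝ} {T₀ T : ℕ}

/-- The regressor `(x, w)` of the label regression, for individual `k.2` in round `k.1`. -/
def regressor (S : Primitives m d n Ω) (w : ℕ → Fin n → Ω → (Fin d → ℝ)) (k : ℕ × Fin n) (ω : Ω) :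
    Fin m ⊕ Fin d → ℝ :=
  Sum.elim (S.x k.1 k.2 ω) (w k.1 k.2 ω)

lemma IsOLS.sum_residual_mul_eq_zero {t : ℕ} {ω : Ω} {F' : Matrix (Fin d) (Fin m) ℝ}
    {G' : Matrix (Fin d) (Fin d) ℝ} (h : IsOLS E S w t ω F' G') (v : Fin d → ℝ)
    (p : Fin m ⊕ Fin d → ℝ) :
    ∑ k ∈ Finset.range t ×ˢ Finset.univ, (v ⬝ᵥ (obsLabel E S w k.1 k.2 ω -
      Matrix.fromCols F' G' *ᵥ regressor S w k ω)) * (p ⬝ᵥ regressor S w k ω) = 0 := by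
  refine PROOFBandit.sum_residual_mul_eq_zero (fun M' => ?_) v p
  have hM' := h M'.toCols₁ M'.toCols₂
  simp only [squaredLoss, sq_l2norm, ← Matrix.fromCols_mulVec_sumElim,
    Matrix.fromCols_toCols] at hM'
  simpa only [Finset.sum_product, regressor] using hM'

lemma IsOLS.sum_noise_mul_eq {t : ℕ} {ω : Ω} {F' : Matrix (Fin d) (Fin m) ℝ}
    {G' : Matrix (Fin d) (Fin d) ℝ} (h : IsOLS E S w t ω F' G') (v : Fin d → ℝ) :
    ∑ k ∈ Finset.range t ×ˢ Finset.univ, (v ⬝ᵥ S.e k.1 k.2 ω) *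
      ((v ᵥ* Matrix.fromCols (F' - E.F) (G' - E.G)) ⬝ᵥ regressor S w k ω) =
    ∑ k ∈ Finset.range t ×ˢ Finset.univ,
      ((v ᵥ* Matrix.fromCols (F' - E.F) (G' - E.G)) ⬝ᵥ regressor S w k ω) ^ 2 := by
  rw [← sub_eq_zero, ← Finset.sum_sub_distrib,
    ← h.sum_residual_mul_eq_zero v (v ᵥ* Matrix.fromCols (F' - E.F) (G' - E.G))]
  refine Finset.sum_congr rfl fun k _ => ?_
  have hres : obsLabel E S w k.1 k.2 ω - Matrix.fromCols F' G' *ᵥ regressor S w k ω =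
      S.e k.1 k.2 ω - Matrix.fromCols (F' - E.F) (G' - E.G) *ᵥ regressor S w k ω := by
    simp only [obsLabel, Env.label, regressor, Matrix.fromCols_mulVec_sumElim, Matrix.sub_mulVec]
    abel
  rw [hres, dotProduct_sub, Matrix.dotProduct_mulVec]
  ring

lemma IsOLS.abs_error_le {t : ℕ} {ω : Ω} {F' : Matrix (Fin d) (Fin m) ℝ}
    {G' : Matrix (Fin d) (Fin d) ℝ} (h : IsOLS E S w t ω F' G') {v : Fin d → ℝ} {ε G N : ℝ}
    (hε : 0 < ε) (hε1 : ε ≤ 1) (hN : 0 < N)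
    (hgram : ∀ p : Fin m ⊕ Fin d → ℝ, N * (p ⬝ᵥ p) ≤
      ∑ k ∈ Finset.range t ×ˢ Finset.univ, (p ⬝ᵥ regressor S w k ω) ^ 2)
    (hnoise : ∀ p : Fin m ⊕ Fin d → ℝ, p ⬝ᵥ p ≤ 1 →
      ∑ k ∈ Finset.range t ×ˢ Finset.univ,
        compensated E.tau p v (regressor S w k ω) (S.e k.1 k.2 ω) ≤ G)
    (x : Fin m → ℝ) (u : Fin d → ℝ) :
    |v ⬝ᵥ ((F' - E.F) *ᵥ x + (G' - E.G) *ᵥ u)| ≤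
      (ε + 2 * E.tau * G / (ε * N)) * √(x ⬝ᵥ x + u ⬝ᵥ u) := by
  set p := v ᵥ* Matrix.fromCols (F' - E.F) (G' - E.G)
  have hp : √(p ⬝ᵥ p) ≤ ε + 2 * E.tau * (G + 0) / (ε * N) :=
    sqrt_dotProduct_self_le_of_compensated_le E.one_le_tau hε hε1 hN (hgram p)
      (fun a => by rw [h.sum_noise_mul_eq v]; simp [p]) hnoise
  rw [add_zero] at hp
  rw [← Matrix.fromCols_mulVec_sumElim, Matrix.dotProduct_mulVec,
    ← sumElim_dotProduct_sumElim x x]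
  exact (abs_dotProduct_le_sqrt_mul_sqrt _ _).trans (by gcongr)

lemma dotProduct_gram_mulVec (w : ℕ → Fin n → Ω → (Fin d → ℝ)) (b : Fin d → Fin d → ℝ) (t : ℕ)
    (i : Fin n) (ω : Ω) (p q : Fin d → ℝ) :
    p ⬝ᵥ gram w b t i ω *ᵥ q = ∑ j, (p ⬝ᵥ b j) * (q ⬝ᵥ b j) +
      ∑ s ∈ Finset.Ico 1 t, (p ⬝ᵥ w s i ω) * (q ⬝ᵥ w s i ω) := by
  simp only [gram, Matrix.add_mulVec, dotProduct_add, Matrix.sum_mulVec, dotProduct_sum,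
    Matrix.vecMulVec_mulVec, op_smul_eq_smul, dotProduct_smul, smul_eq_mul, dotProduct_comm _ q,
    mul_comm]

lemma isUnit_gram_det {t : ℕ} {i : Fin n} {ω : Ω} {N : ℝ} (hN : 0 < N)
    (hgram : ∀ p : Fin d → ℝ, N * (p ⬝ᵥ p) ≤ p ⬝ᵥ gram w b t i ω *ᵥ p) :
    IsUnit (gram w b t i ω).det := by
  rw [isUnit_iff_ne_zero]
  intro hdet
  obtain ⟨v, hv0, hv⟩ := Matrix.exists_mulVec_eq_zero_iff.2 hdet
  have hvv := hgram v
  rw [hv, dotProduct_zero] at hvv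
  exact hv0 (dotProduct_self_eq_zero.1 (le_antisymm
    (nonpos_of_mul_nonpos_right hvv hN) (dotProduct_self_nonneg v)))

lemma dotProduct_gram_mulVec_muHat_sub {t : ℕ} {i : Fin n} {ω : Ω}
    (hdet : IsUnit (gram w b t i ω).det) (p : Fin d → ℝ) :
    p ⬝ᵥ gram w b t i ω *ᵥ (muHat E S w b t i ω - E.μ) =
      ∑ s ∈ Finset.Ico 1 t, S.η s i ω * (p ⬝ᵥ w s i ω) - ∑ j, (p ⬝ᵥ b j) * (E.μ ⬝ᵥ b j) := by
  rw [Matrix.mulVec_sub, dotProduct_sub, dotProduct_gram_mulVec w b t i ω p E.μ, muHat,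
    Matrix.mulVec_mulVec, Matrix.mul_nonsing_inv _ hdet, Matrix.one_mulVec, dotProduct_sum,
    add_comm (∑ j, _), ← sub_sub, ← Finset.sum_sub_distrib]
  congr 1
  refine Finset.sum_congr rfl fun s _ => ?_
  rw [dotProduct_smul, smul_eq_mul, obsBandit]
  ring

lemma neg_sum_mul_le {ι : Type*} (s : Finset ι) (f g : ι → ℝ) {τ : ℝ} (hτ : 1 ≤ τ) (a : ℝ) :
    -(a * ∑ j ∈ s, f j * g j) ≤ τ / 2 * a ^ 2 * ∑ j ∈ s, f j ^ 2 + ∑ j ∈ s, g j ^ 2 / 2 := by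
  rw [Finset.mul_sum, Finset.mul_sum, ← Finset.sum_neg_distrib, ← Finset.sum_add_distrib]
  exact Finset.sum_le_sum fun j _ => by
    nlinarith [sq_nonneg (a * f j + g j), mul_nonneg (sub_nonneg.2 hτ) (sq_nonneg (a * f j))]

lemma l2norm_muHat_sub_le (hE : E.IsRegular KX KC Kμ KS) (hb : ∀ j, b j ∈ E.W) {t : ℕ}
    {i : Fin n} {ω : Ω} {ε G N : ℝ} (hε : 0 < ε) (hε1 : ε ≤ 1) (hN : 0 < N)
    (hgram : ∀ p : Fin d → ℝ, N * (p ⬝ᵥ p) ≤ p ⬝ᵥ gram w b t i ω *ᵥ p)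
    (hnoise : ∀ p : Fin d → ℝ, p ⬝ᵥ p ≤ 1 → ∑ s ∈ Finset.Ico 1 t,
      compensated E.tau p 1 (w s i ω) (fun _ : Unit => S.η s i ω) ≤ G) :
    l2norm (muHat E S w b t i ω - E.μ) ≤
      ε + 2 * E.tau * (G + d * (Kμ ^ 2 / 2)) / (ε * N) := by
  set δ := muHat E S w b t i ω - E.μ with hδ
  have hμ : E.μ ⬝ᵥ E.μ ≤ Kμ ^ 2 :=
    (l2norm_le_iff ((Real.sqrt_nonneg _).trans hE.norm_mu)).1 hE.norm_mu
  have hbias : ∑ j, (E.μ ⬝ᵥ b j) ^ 2 / 2 ≤ d * (Kμ ^ 2 / 2) := by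
    simpa using Finset.sum_le_card_nsmul Finset.univ _ (Kμ ^ 2 / 2) fun j _ =>
      div_le_div_of_nonneg_right ((sq_dotProduct_le _ _).trans
        ((mul_le_of_le_one_right (dotProduct_self_nonneg _)
          (hE.dotProduct_action_le (hb j))).trans hμ)) zero_le_two
  refine sqrt_dotProduct_self_le_of_compensated_le E.one_le_tau hε hε1 hN (hgram δ)
    (fun a => ?_) hnoise
  have hfit := dotProduct_gram_mulVec_muHat_sub (E := E) (S := S) (isUnit_gram_det hN hgram) δ
  have hridge := neg_sum_mul_le Finset.univ (δ ⬝ᵥ b ·) (E.μ ⬝ᵥ b ·) E.one_le_tau a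
  have hsplit : δ ⬝ᵥ gram w b t i ω *ᵥ δ - ∑ s ∈ Finset.Ico 1 t, (δ ⬝ᵥ w s i ω) ^ 2 =
      ∑ j, (δ ⬝ᵥ b j) ^ 2 := by
    simp only [dotProduct_gram_mulVec, sq]
    ring
  have hone (s : ℕ) : (1 : Unit → ℝ) ⬝ᵥ (fun _ => S.η s i ω) = S.η s i ω := by simp
  rw [← hδ] at hfit
  rw [hsplit, hfit]
  simp only [hone]
  linarith

lemma l2norm_sub_muHat_le {t : ℕ} {i : Fin n} {ω : Ω} {N : ℝ} (hN : 0 < N)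
    (hgram : ∀ p : Fin d → ℝ, N * (p ⬝ᵥ p) ≤ p ⬝ᵥ gram w b t i ω *ᵥ p) {ν : Fin d → ℝ}
    (hν : ν ∈ confBall E S w b γ t i ω) :
    l2norm (ν - muHat E S w b t i ω) ≤ √(radius d n γ t / N) := by
  refine Real.sqrt_le_sqrt ((le_div_iff₀' hN).2 ((hgram _).trans ?_))
  exact (Real.sqrt_le_sqrt_iff (le_max_of_le_right (sq_nonneg _))).1 hν

lemma IsOptimisticChoice.le_add {W B : Set (Fin d → ℝ)} {chat c : (Fin d → ℝ) → (Fin d → ℝ)}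
    {v v' : Fin d → ℝ} (h : IsOptimisticChoice W B chat v) (hv' : v' ∈ W) {r : ℝ}
    (hr : ∀ u ∈ W, ∀ ν ∈ B, |(chat u + ν) ⬝ᵥ u - c u ⬝ᵥ u| ≤ r) :
    c v ⬝ᵥ v ≤ c v' ⬝ᵥ v' + 2 * r := by
  obtain ⟨hv, ν, hν, hle⟩ := h
  linarith [hle v' hv' ν hν, abs_le.1 (hr v hv ν hν), abs_le.1 (hr v' hv' ν hν)]

end EstimationErrors

/-! ### Second moments of the exploratory actions -/

section SecondMoments

variable {ι α Ω : Type*} [Fintype ι] [MeasurableSpace Ω] {P : Measure Ω}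

lemma abs_mul_le_of_dotProduct_self_le {v : ι → ℝ} {L : ℝ} (hv : v ⬝ᵥ v ≤ L) (a b : ι) :
    |v a * v b| ≤ L := by
  have hsq (a : ι) : v a ^ 2 ≤ L := by
    rw [pow_two]
    exact (Finset.single_le_sum (f := fun i => v i * v i) (fun i _ => mul_self_nonneg _)
      (Finset.mem_univ a)).trans hv
  rw [abs_le]
  constructor <;> nlinarith [hsq a, hsq b, sq_nonneg (v a + v b), sq_nonneg (v a - v b)]

lemma sum_sq_mul_eq (v : ι → ℝ) : ∑ a, ∑ b, (v a * v b) ^ 2 = (v ⬝ᵥ v) ^ 2 := by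
  rw [pow_two, dotProduct, Finset.sum_mul_sum]
  exact Finset.sum_congr rfl fun a _ => Finset.sum_congr rfl fun b _ => by ring

lemma dotProduct_mulVec_eq_sum (M : Matrix ι ι ℝ) (p : ι → ℝ) :
    p ⬝ᵥ M *ᵥ p = ∑ a, ∑ b, p a * p b * M a b := by
  simp only [dotProduct, Matrix.mulVec, Finset.mul_sum]
  exact Finset.sum_congr rfl fun a _ => Finset.sum_congr rfl fun b _ => by ring

lemma sq_dotProduct_mulVec_le (M : Matrix ι ι ℝ) (p : ι → ℝ) :
    (p ⬝ᵥ M *ᵥ p) ^ 2 ≤ (p ⬝ᵥ p) ^ 2 * ∑ a, ∑ b, M a b ^ 2 := by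
  rw [dotProduct_mulVec_eq_sum, ← sum_sq_mul_eq]
  simp only [← Fintype.sum_prod_type']
  exact Finset.sum_mul_sq_le_sq_mul_sq _ _ _

lemma memLp_mul_of_dotProduct_self_le [IsFiniteMeasure P] {v : Ω → ι → ℝ} (hv : Measurable v)
    {L : ℝ} (hL : ∀ᵐ ω ∂P, v ω ⬝ᵥ v ω ≤ L) (a b : ι) : MemLp (fun ω => v ω a * v ω b) 2 P :=
  MemLp.of_bound (by fun_prop) L
    (hL.mono fun _ h => abs_mul_le_of_dotProduct_self_le h a b)

/-- Second moment matrix of a probability measure on coordinate vectors. -/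
def secondMoment (ν : Measure (ι → ℝ)) : Matrix ι ι ℝ :=
  Matrix.of fun a b => ∫ x, x a * x b ∂ν

variable {ν : Measure (ι → ℝ)} [IsProbabilityMeasure ν] {R l : ℝ}

lemma integral_dotProduct_mul_dotProduct (hR : ∀ᵐ x ∂ν, x ⬝ᵥ x ≤ R) (p q : ι → ℝ) :
    ∫ x, (p ⬝ᵥ x) * (q ⬝ᵥ x) ∂ν = p ⬝ᵥ secondMoment ν *ᵥ q := by
  have hint (a b : ι) : Integrable (fun x : ι → ℝ => p a * q b * (x a * x b)) ν :=
    ((memLp_mul_of_dotProduct_self_le measurable_id hR a b).integrable one_le_two).const_mul _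
  calc ∫ x, (p ⬝ᵥ x) * (q ⬝ᵥ x) ∂ν = ∫ x, ∑ a, ∑ b, p a * q b * (x a * x b) ∂ν := by
        simp only [dotProduct, Finset.sum_mul_sum, mul_mul_mul_comm]
    _ = ∑ a, ∑ b, p a * q b * ∫ x, x a * x b ∂ν := by
        rw [integral_finsetSum _ fun a _ => integrable_finsetSum _ fun b _ => hint a b]
        simp only [integral_finsetSum _ fun b _ => hint _ b, integral_const_mul]
    _ = p ⬝ᵥ secondMoment ν *ᵥ q := by
        simp only [dotProduct, Matrix.mulVec, secondMoment, Matrix.of_apply, Finset.mul_sum,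
          mul_assoc, mul_comm (q _)]

lemma posDef_secondMoment (hR : ∀ᵐ x ∂ν, x ⬝ᵥ x ≤ R) (hl : 0 < l)
    (hν : ∀ p : ι → ℝ, l * (p ⬝ᵥ p) ≤ ∫ x, (p ⬝ᵥ x) ^ 2 ∂ν) : (secondMoment ν).PosDef := by
  refine Matrix.PosDef.of_dotProduct_mulVec_pos ?_ fun p hp => ?_
  · ext a b
    simp [secondMoment, mul_comm]
  · have hp' : 0 < p ⬝ᵥ p := by simpa using Matrix.dotProduct_star_self_pos_iff.2 hp
    simpa [← integral_dotProduct_mul_dotProduct hR, ← pow_two] using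
      (mul_pos hl hp').trans_le (hν p)

lemma dotProduct_self_le_div (hl : 0 < l) {v p x : ι → ℝ} (hv : v ⬝ᵥ v = p ⬝ᵥ x)
    (hp : l * (p ⬝ᵥ p) ≤ v ⬝ᵥ v) (hx : x ⬝ᵥ x ≤ R) : v ⬝ᵥ v ≤ R / l := by
  have hv0 := dotProduct_self_nonneg v
  have hsq : (v ⬝ᵥ v) ^ 2 ≤ (p ⬝ᵥ p) * (x ⬝ᵥ x) := hv ▸ sq_dotProduct_le p x
  have hprod : l * (v ⬝ᵥ v) * (v ⬝ᵥ v) ≤ R * (v ⬝ᵥ v) := by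
    nlinarith [mul_le_mul_of_nonneg_left hsq hl.le, mul_le_mul_of_nonneg_left hx hv0,
      mul_le_mul_of_nonneg_right hp (dotProduct_self_nonneg x)]
  rw [le_div_iff₀ hl]
  rcases hv0.eq_or_lt with hv0 | hv0
  · rw [← hv0]
    linarith [dotProduct_self_nonneg x]
  · linarith [le_of_mul_le_mul_right hprod hv0]

variable [DecidableEq ι]

/-- Deviation of the empirical second moment matrix of the vectors `y k`, `k ∈ J`, from the
identity, multiplied by the number of vectors. -/
def secondMomentDeviation (J : Finset α) (y : α → ι → ℝ) : Matrix ι ι ℝ :=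
  Matrix.of fun a b => ∑ k ∈ J, (y k a * y k b - (1 : Matrix ι ι ℝ) a b)

lemma dotProduct_secondMomentDeviation_mulVec (J : Finset α) (y : α → ι → ℝ) (p : ι → ℝ) :
    p ⬝ᵥ secondMomentDeviation J y *ᵥ p = ∑ k ∈ J, (p ⬝ᵥ y k) ^ 2 - J.card * (p ⬝ᵥ p) := by
  have hone : ∑ a, ∑ b, p a * p b * (1 : Matrix ι ι ℝ) a b = p ⬝ᵥ p := by
    rw [← dotProduct_mulVec_eq_sum, Matrix.one_mulVec]
  have hsq (k : α) : ∑ a, ∑ b, p a * p b * (y k a * y k b) = (p ⬝ᵥ y k) ^ 2 := by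
    rw [pow_two, dotProduct, Finset.sum_mul_sum]
    exact Finset.sum_congr rfl fun a _ => Finset.sum_congr rfl fun b _ => by ring
  calc p ⬝ᵥ secondMomentDeviation J y *ᵥ p
      = ∑ a, ∑ b, ∑ k ∈ J, (p a * p b * (y k a * y k b) - p a * p b * (1 : Matrix ι ι ℝ) a b) := by
        simp only [dotProduct_mulVec_eq_sum, secondMomentDeviation, Matrix.of_apply,
          Finset.mul_sum, mul_sub]
    _ = ∑ k ∈ J, (∑ a, ∑ b, p a * p b * (y k a * y k b) -
          ∑ a, ∑ b, p a * p b * (1 : Matrix ι ι ℝ) a b) := by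
        simp only [← Finset.sum_sub_distrib, Finset.sum_comm (s := Finset.univ) (t := J)]
    _ = ∑ k ∈ J, (p ⬝ᵥ y k) ^ 2 - J.card * (p ⬝ᵥ p) := by
        simp only [hone, hsq, Finset.sum_sub_distrib, Finset.sum_const, nsmul_eq_mul]

lemma half_card_mul_le_sum_sq {J : Finset α} {y : α → ι → ℝ}
    (h : 4 * ∑ a, ∑ b, secondMomentDeviation J y a b ^ 2 ≤ (J.card : ℝ) ^ 2) (p : ι → ℝ) :
    J.card / 2 * (p ⬝ᵥ p) ≤ ∑ k ∈ J, (p ⬝ᵥ y k) ^ 2 := by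
  have hp := dotProduct_self_nonneg p
  have hle := abs_le_of_sq_le_sq (a := p ⬝ᵥ secondMomentDeviation J y *ᵥ p)
    (b := J.card / 2 * (p ⬝ᵥ p)) ((sq_dotProduct_mulVec_le _ p).trans (by
      nlinarith [mul_le_mul_of_nonneg_left h (sq_nonneg (p ⬝ᵥ p))])) (by positivity)
  rw [dotProduct_secondMomentDeviation_mulVec] at hle
  linarith [(abs_le.1 hle).1]

variable [IsProbabilityMeasure P] {J : Finset α} {y : α → Ω → ι → ℝ} {L : ℝ}

lemma memLp_secondMomentDeviation (hy : ∀ k ∈ J, Measurable (y k))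
    (hL : ∀ k ∈ J, ∀ᵐ ω ∂P, y k ω ⬝ᵥ y k ω ≤ L) (a b : ι) :
    MemLp (fun ω => secondMomentDeviation J (fun k => y k ω) a b) 2 P :=
  memLp_finsetSum J fun k hk =>
    (memLp_mul_of_dotProduct_self_le (hy k hk) (hL k hk) a b).sub (memLp_const _)

lemma integral_sq_secondMomentDeviation_le (hy : ∀ k ∈ J, Measurable (y k))
    (hL : ∀ k ∈ J, ∀ᵐ ω ∂P, y k ω ⬝ᵥ y k ω ≤ L)
    (hindep : Set.Pairwise (J : Set α) fun k l => IndepFun (y k) (y l) P)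
    (hiso : ∀ k ∈ J, ∀ a b, ∫ ω, y k ω a * y k ω b ∂P = (1 : Matrix ι ι ℝ) a b) (a b : ι) :
    ∫ ω, secondMomentDeviation J (fun k => y k ω) a b ^ 2 ∂P ≤
      ∑ k ∈ J, ∫ ω, (y k ω a * y k ω b) ^ 2 ∂P := by
  have hmem (k : α) (hk : k ∈ J) := memLp_mul_of_dotProduct_self_le (hy k hk) (hL k hk) a b
  have hmean : ∫ ω, ∑ k ∈ J, y k ω a * y k ω b ∂P = ∑ _k ∈ J, (1 : Matrix ι ι ℝ) a b := by
    rw [integral_finsetSum _ fun k hk => (hmem k hk).integrable one_le_two]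
    exact Finset.sum_congr rfl fun k hk => hiso k hk a b
  have hmul : Measurable fun v : ι → ℝ => v a * v b := by fun_prop
  calc ∫ ω, secondMomentDeviation J (fun k => y k ω) a b ^ 2 ∂P
      = Var[fun ω => ∑ k ∈ J, y k ω a * y k ω b; P] := by
        rw [variance_eq_integral (memLp_finsetSum J hmem).aestronglyMeasurable.aemeasurable,
          hmean]
        simp only [secondMomentDeviation, Matrix.of_apply, Finset.sum_sub_distrib]
    _ = ∑ k ∈ J, Var[fun ω => y k ω a * y k ω b; P] := by
        rw [← IndepFun.variance_sum hmem fun k hk l hl hkl =>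
          (hindep hk hl hkl).comp hmul hmul]
        congr 1
        ext ω
        simp only [Finset.sum_apply]
    _ ≤ ∑ k ∈ J, ∫ ω, (y k ω a * y k ω b) ^ 2 ∂P :=
        Finset.sum_le_sum fun k hk =>
          variance_le_expectation_sq (hmem k hk).aestronglyMeasurable

lemma sum_integral_sq_mul_le {v : Ω → ι → ℝ} (hv : Measurable v)
    (hL : ∀ᵐ ω ∂P, v ω ⬝ᵥ v ω ≤ L)
    (hiso : ∀ a b, ∫ ω, v ω a * v ω b ∂P = (1 : Matrix ι ι ℝ) a b) :
    ∑ a, ∑ b, ∫ ω, (v ω a * v ω b) ^ 2 ∂P ≤ L * Fintype.card ι := by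
  have hmem := memLp_mul_of_dotProduct_self_le hv hL
  have hint (a b : ι) : Integrable (fun ω => (v ω a * v ω b) ^ 2) P := (hmem a b).integrable_sq
  have hdot : Integrable (fun ω => v ω ⬝ᵥ v ω) P :=
    integrable_finsetSum _ fun a _ => (hmem a a).integrable one_le_two
  calc ∑ a, ∑ b, ∫ ω, (v ω a * v ω b) ^ 2 ∂P
      = ∫ ω, (v ω ⬝ᵥ v ω) ^ 2 ∂P := by
        simp only [← sum_sq_mul_eq]
        rw [integral_finsetSum _ fun a _ => integrable_finsetSum _ fun b _ => hint a b]
        exact Finset.sum_congr rfl fun a _ => (integral_finsetSum _ fun b _ => hint a b).symm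
    _ ≤ ∫ ω, L * (v ω ⬝ᵥ v ω) ∂P := by
        refine integral_mono_ae ?_ (hdot.const_mul L) (hL.mono fun ω h => ?_)
        · simp only [← sum_sq_mul_eq]
          exact integrable_finsetSum _ fun a _ => integrable_finsetSum _ fun b _ => hint a b
        · dsimp only
          nlinarith [dotProduct_self_nonneg (v ω)]
    _ = L * Fintype.card ι := by
        simp only [integral_const_mul, dotProduct]
        rw [integral_finsetSum _ fun a _ => (hmem a a).integrable one_le_two]
        simp [hiso]

lemma exists_half_card_mul_le_sum_sq (hy : ∀ k ∈ J, Measurable (y k))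
    (hL : ∀ k ∈ J, ∀ᵐ ω ∂P, y k ω ⬝ᵥ y k ω ≤ L)
    (hindep : Set.Pairwise (J : Set α) fun k l => IndepFun (y k) (y l) P)
    (hiso : ∀ k ∈ J, ∀ a b, ∫ ω, y k ω a * y k ω b ∂P = (1 : Matrix ι ι ℝ) a b)
    (hJ : J.Nonempty) :
    ∃ Z : Ω → ℝ, Integrable Z P ∧ 0 ≤ Z ∧ ∫ ω, Z ω ∂P ≤ 4 * (L * Fintype.card ι) / J.card ∧
      ∀ ω, Z ω ≤ 1 → ∀ p, J.card / 2 * (p ⬝ᵥ p) ≤ ∑ k ∈ J, (p ⬝ᵥ y k ω) ^ 2 := by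
  have hcard : (0 : ℝ) < J.card := by exact_mod_cast hJ.card_pos
  have hint (a b : ι) := (memLp_secondMomentDeviation hy hL a b).integrable_sq
  refine ⟨fun ω => 4 / (J.card : ℝ) ^ 2 *
    ∑ a, ∑ b, secondMomentDeviation J (fun k => y k ω) a b ^ 2,
    (integrable_finsetSum _ fun a _ => integrable_finsetSum _ fun b _ => hint a b).const_mul _,
    fun ω => by positivity, ?_, fun ω h => half_card_mul_le_sum_sq ?_⟩
  · calc ∫ ω, 4 / (J.card : ℝ) ^ 2 *
          ∑ a, ∑ b, secondMomentDeviation J (fun k => y k ω) a b ^ 2 ∂P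
        = 4 / (J.card : ℝ) ^ 2 *
            ∑ a, ∑ b, ∫ ω, secondMomentDeviation J (fun k => y k ω) a b ^ 2 ∂P := by
          rw [integral_const_mul,
            integral_finsetSum _ fun a _ => integrable_finsetSum _ fun b _ => hint a b]
          simp only [integral_finsetSum _ fun b _ => hint _ b]
      _ ≤ 4 / (J.card : ℝ) ^ 2 * ∑ a, ∑ b, ∑ k ∈ J, ∫ ω, (y k ω a * y k ω b) ^ 2 ∂P := by
          gcongr
          exact integral_sq_secondMomentDeviation_le hy hL hindep hiso _ _
      _ = 4 / (J.card : ℝ) ^ 2 * ∑ k ∈ J, ∑ a, ∑ b, ∫ ω, (y k ω a * y k ω b) ^ 2 ∂P := by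
          simp only [Finset.sum_comm (s := Finset.univ) (t := J)]
      _ ≤ 4 / (J.card : ℝ) ^ 2 * (J.card * (L * Fintype.card ι)) := by
          gcongr
          rw [← nsmul_eq_mul]
          exact Finset.sum_le_card_nsmul _ _ _ fun k hk =>
            sum_integral_sq_mul_le (hy k hk) (hL k hk) (hiso k hk)
      _ = 4 * (L * Fintype.card ι) / J.card := by field_simp
  · dsimp only at h
    rwa [div_mul_eq_mul_div, div_le_one (pow_pos hcard 2)] at h

lemma exists_isUnit_transpose_mul_self_eq {M : Matrix ι ι ℝ} (hM : M.PosDef) :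
    ∃ B : Matrix ι ι ℝ, IsUnit B ∧ Bᵀ * B = M := by
  open scoped MatrixOrder Matrix.Norms.L2Operator in
  obtain ⟨B, hB, hMB⟩ := CStarAlgebra.isStrictlyPositive_iff_eq_star_mul_self.1
    (Matrix.isStrictlyPositive_iff_posDef.2 hM)
  exact ⟨B, hB, by
    rw [hMB, Matrix.star_eq_conjTranspose, Matrix.conjTranspose_eq_transpose_of_trivial]⟩

lemma exists_whitening (hR : ∀ᵐ x ∂ν, x ⬝ᵥ x ≤ R) (hl : 0 < l)
    (hν : ∀ p : ι → ℝ, l * (p ⬝ᵥ p) ≤ ∫ x, (p ⬝ᵥ x) ^ 2 ∂ν) :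
    ∃ A B : Matrix ι ι ℝ, (∀ p x, (B *ᵥ p) ⬝ᵥ (A *ᵥ x) = p ⬝ᵥ x) ∧
      (∀ p, l * (p ⬝ᵥ p) ≤ (B *ᵥ p) ⬝ᵥ (B *ᵥ p)) ∧
      (∀ a b, ∫ x, (A *ᵥ x) a * (A *ᵥ x) b ∂ν = (1 : Matrix ι ι ℝ) a b) ∧
      ∀ᵐ x ∂ν, (A *ᵥ x) ⬝ᵥ (A *ᵥ x) ≤ R / l := by
  obtain ⟨B, hB, hBM⟩ := exists_isUnit_transpose_mul_self_eq (posDef_secondMoment hR hl hν)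
  have hdet : IsUnit B.det := (Matrix.isUnit_iff_isUnit_det B).1 hB
  have hpair (p q : ι → ℝ) : (B *ᵥ p) ⬝ᵥ (B *ᵥ q) = ∫ x, (p ⬝ᵥ x) * (q ⬝ᵥ x) ∂ν := by
    rw [integral_dotProduct_mul_dotProduct hR, ← hBM, ← Matrix.mulVec_mulVec,
      Matrix.dotProduct_transpose_mulVec, dotProduct_comm]
  have hlow (p : ι → ℝ) : l * (p ⬝ᵥ p) ≤ (B *ᵥ p) ⬝ᵥ (B *ᵥ p) := by
    simpa only [hpair, ← pow_two] using hν p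
  have hadj (p x : ι → ℝ) : (B *ᵥ p) ⬝ᵥ ((B⁻¹)ᵀ *ᵥ x) = p ⬝ᵥ x := by
    rw [Matrix.dotProduct_transpose_mulVec, Matrix.mulVec_mulVec, Matrix.nonsing_inv_mul B hdet,
      Matrix.one_mulVec, dotProduct_comm]
  have hcancel (y : ι → ℝ) : B *ᵥ B⁻¹ *ᵥ y = y := by
    rw [Matrix.mulVec_mulVec, Matrix.mul_nonsing_inv B hdet, Matrix.one_mulVec]
  refine ⟨(B⁻¹)ᵀ, B, hadj, hlow, fun a b => ?_, hR.mono fun x hx => ?_⟩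
  · have hcol (a : ι) : B *ᵥ (B⁻¹)ᵀ a = Pi.single a 1 := by
      rw [← hcancel (Pi.single a 1), Matrix.mulVec_single_one]
      rfl
    exact (hpair _ _).symm.trans (by rw [hcol, hcol]; simp [Matrix.one_eq_pi_single])
  · refine dotProduct_self_le_div hl (p := B⁻¹ *ᵥ (B⁻¹)ᵀ *ᵥ x) ?_ ?_ hx
    · rw [← hadj (B⁻¹ *ᵥ _), hcancel]
    · simpa only [hcancel] using hlow (B⁻¹ *ᵥ (B⁻¹)ᵀ *ᵥ x)

omit [DecidableEq ι] in
-- After whitening, Chebyshev's inequality applies to the second moment matrix entry by entry.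
theorem exists_eigenvalue_mul_le_sum_sq {J : Finset α} {z : α → Ω → ι → ℝ}
    (hR : ∀ᵐ x ∂ν, x ⬝ᵥ x ≤ R) (hl : 0 < l)
    (hν : ∀ p : ι → ℝ, l * (p ⬝ᵥ p) ≤ ∫ x, (p ⬝ᵥ x) ^ 2 ∂ν)
    (hz : ∀ k ∈ J, Measurable (z k)) (hlaw : ∀ k ∈ J, P.map (z k) = ν)
    (hindep : Set.Pairwise (J : Set α) fun k k' => IndepFun (z k) (z k') P) (hJ : J.Nonempty) :
    ∃ Z : Ω → ℝ, Integrable Z P ∧ 0 ≤ Z ∧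
      ∫ ω, Z ω ∂P ≤ 4 * (R / l * Fintype.card ι) / J.card ∧
      ∀ ω, Z ω ≤ 1 → ∀ p, J.card / 2 * l * (p ⬝ᵥ p) ≤ ∑ k ∈ J, (p ⬝ᵥ z k ω) ^ 2 := by
  classical
  obtain ⟨A, B, hadj, hlow, hiso, hA⟩ := exists_whitening hR hl hν
  have hmeas : Measurable fun x : ι → ℝ => A *ᵥ x := by fun_prop
  obtain ⟨Z, hZint, hZ0, hZ, hbound⟩ := exists_half_card_mul_le_sum_sq (P := P) (J := J)
    (y := fun k ω => A *ᵥ z k ω) (L := R / l) (fun k hk => hmeas.comp (hz k hk))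
    (fun k hk => ae_of_ae_map (hz k hk).aemeasurable (by rwa [hlaw k hk]))
    (fun k hk k' hk' h => (hindep hk hk' h).comp hmeas hmeas)
    (fun k hk a b => by
      rw [← hiso, ← hlaw k hk, integral_map (hz k hk).aemeasurable (by fun_prop)]) hJ
  refine ⟨Z, hZint, hZ0, hZ, fun ω h p => ?_⟩
  calc J.card / 2 * l * (p ⬝ᵥ p) ≤ J.card / 2 * ((B *ᵥ p) ⬝ᵥ (B *ᵥ p)) := by
        rw [mul_assoc]
        gcongr
        exact hlow p
    _ ≤ ∑ k ∈ J, (p ⬝ᵥ z k ω) ^ 2 := by simpa only [hadj] using hbound ω h (B *ᵥ p)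

end SecondMoments

/-! ### Estimation errors along a run -/

section Run

variable {m d n : ℕ} {Ω : Type*} {S : Primitives m d n Ω} {E : Env m d} {KX KC Kμ KS : ℝ}
  {w : ℕ → Fin n → Ω → (Fin d → ℝ)} {b : Fin d → Fin d → ℝ} {γ : ℝ} {T₀ T : ℕ}

lemma regressor_dotProduct_self_le (hE : E.IsRegular KX KC Kμ KS) {k : ℕ × Fin n} {ω : Ω}
    (hx : S.x k.1 k.2 ω ∈ E.X) (hw : w k.1 k.2 ω ∈ E.W) :
    regressor S w k ω ⬝ᵥ regressor S w k ω ≤ √(KX ^ 2 + 1) ^ 2 := by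
  rw [Real.sq_sqrt (by positivity), regressor, sumElim_dotProduct_sumElim]
  exact add_le_add (hE.dotProduct_feature_le hx) (hE.dotProduct_action_le hw)

lemma compensated_elim_zero_noise {ι : Type*} [Fintype ι] (τ : ℝ) (p z : ι → ℝ) (v : Fin d → ℝ)
    (t : ℕ) (i : Fin n) (ω : Ω) :
    compensated τ p (Sum.elim v 0) z (S.noise t i ω) = compensated τ p v z (S.e t i ω) := by
  simp [compensated, Primitives.noise]

lemma compensated_zero_elim_noise {ι : Type*} [Fintype ι] (τ : ℝ) (p z : ι → ℝ) (v : Unit → ℝ)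
    (t : ℕ) (i : Fin n) (ω : Ω) :
    compensated τ p (Sum.elim (0 : Fin d → ℝ) v) z (S.noise t i ω) =
      compensated τ p v z fun _ => S.η t i ω := by
  simp [compensated, Primitives.noise]

namespace IsRun

lemma action_mem (hrun : IsRun E S w b γ T₀ T) {t : ℕ} (ht : t ≤ T) (i : Fin n) {ω : Ω}
    (hu : S.u t i ω ∈ E.W) : w t i ω ∈ E.W := by
  rcases Nat.eq_zero_or_pos t with rfl | h0
  · exact hrun.initial i ω
  · rcases le_or_gt t T₀ with h | h
    · rwa [hrun.explore t h0 h ht i]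
    · obtain ⟨F', G', -, hchoice⟩ := hrun.exploit t h ht ω
      exact (hchoice i).1

lemma measurable_regressor (hrun : IsRun E S w b γ T₀ T) {k : ℕ × Fin n} (hk : k.1 ≤ T) :
    Measurable[S.info k.1] (regressor S w k) := by
  refine @measurable_pi_lambda _ _ _ (_) _ _ fun j => ?_
  rcases j with j | j
  · exact (measurable_pi_apply j).comp (Primitives.measurable_x_info k.1 k.2)
  · exact (measurable_pi_apply j).comp (hrun.adapted k.1 hk k.2)

lemma sum_sq_exploration_le (hrun : IsRun E S w b γ T₀ T) {t : ℕ} (ht₀ : T₀ < t) (ht : t ≤ T)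
    (p : Fin m ⊕ Fin d → ℝ) (ω : Ω) :
    ∑ k ∈ Finset.Icc 1 T₀ ×ˢ Finset.univ, (p ⬝ᵥ regressor S S.u k ω) ^ 2 ≤
      ∑ k ∈ Finset.range t ×ˢ Finset.univ, (p ⬝ᵥ regressor S w k ω) ^ 2 := by
  have hexplore : ∀ k ∈ Finset.Icc 1 T₀ ×ˢ (Finset.univ : Finset (Fin n)),
      (p ⬝ᵥ regressor S S.u k ω) ^ 2 = (p ⬝ᵥ regressor S w k ω) ^ 2 := fun k hk => by
    obtain ⟨h1, hT₀⟩ := Finset.mem_Icc.1 (Finset.mem_product.1 hk).1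
    rw [regressor, regressor, hrun.explore k.1 h1 hT₀ (hT₀.trans (ht₀.le.trans ht)) k.2]
  rw [Finset.sum_congr rfl hexplore]
  refine Finset.sum_le_sum_of_subset_of_nonneg
    (Finset.product_subset_product_left fun s hs => ?_) fun _ _ _ => sq_nonneg _
  exact Finset.mem_range.2 ((Finset.mem_Icc.1 hs).2.trans_lt ht₀)

lemma sum_sq_exploration_le_gram (hrun : IsRun E S w b γ T₀ T) {t : ℕ} (ht₀ : T₀ < t)
    (ht : t ≤ T) (i : Fin n) (p : Fin d → ℝ) (ω : Ω) :
    ∑ s ∈ Finset.Icc 1 T₀, (p ⬝ᵥ S.u s i ω) ^ 2 ≤ p ⬝ᵥ gram w b t i ω *ᵥ p := by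
  have hexplore : ∀ s ∈ Finset.Icc 1 T₀, (p ⬝ᵥ S.u s i ω) ^ 2 = (p ⬝ᵥ w s i ω) ^ 2 := fun s hs => by
    obtain ⟨h1, hT₀⟩ := Finset.mem_Icc.1 hs
    rw [hrun.explore s h1 hT₀ (hT₀.trans (ht₀.le.trans ht)) i]
  rw [Finset.sum_congr rfl hexplore, dotProduct_gram_mulVec]
  simp only [← sq]
  refine le_add_of_nonneg_of_le (Finset.sum_nonneg fun _ _ => sq_nonneg _)
    (Finset.sum_le_sum_of_subset_of_nonneg (fun s hs => ?_) fun _ _ _ => sq_nonneg _)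
  obtain ⟨h1, hT₀⟩ := Finset.mem_Icc.1 hs
  exact Finset.mem_Ico.2 ⟨h1, hT₀.trans_lt ht₀⟩

end IsRun

variable [MeasurableSpace Ω] {P : Measure Ω}

/-- Half of the lower bound `k * (KS / D)` on the eigenvalues of the expected Gram matrix of `k`
exploratory regressors. The Gram matrix itself stays above it outside an unlikely event. -/
def gramFloor (KS D k : ℝ) : ℝ := k / 2 * (KS / D)

lemma gramFloor_pos {KS D k : ℝ} (hKS : 0 < KS) (hD : 0 < D) (hk : 0 < k) :
    0 < gramFloor KS D k := by
  unfold gramFloor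
  positivity

lemma ae_prod_unif_mem (hE : E.IsRegular KX KC Kμ KS) :
    ∀ᵐ z ∂(E.Dx.prod E.unif), z.1 ∈ E.X ∧ z.2 ∈ E.W := by
  have := hE.prob
  have := hE.isProbabilityMeasure_unif
  exact (Measure.quasiMeasurePreserving_fst.ae hE.ae_mem).and
    (Measure.quasiMeasurePreserving_snd.ae (ae_cond_mem hE.measurableSet_action))

namespace Primitives.IsSample

lemma ae_mem (hS : S.IsSample P E) (hE : E.IsRegular KX KC Kμ KS) :
    ∀ᵐ ω ∂P, ∀ t i, S.x t i ω ∈ E.X ∧ S.u t i ω ∈ E.W := by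
  refine ae_all_iff.2 fun t => ae_all_iff.2 fun i => ?_
  have hmem := ae_prod_unif_mem hE
  rw [← hS.map_feature hE t i] at hmem
  exact ae_of_ae_map ((hS.measurable_x t i).prodMk (hS.measurable_u t i)).aemeasurable hmem

variable [IsProbabilityMeasure P]

lemma exists_exploration_gram_bound (hS : S.IsSample P E) (hE : E.IsRegular KX KC Kμ KS)
    {ι : Type*} [Fintype ι] {f : (Fin m → ℝ) × (Fin d → ℝ) → ι → ℝ} (hf : Measurable f)
    {R l : ℝ} (hR : ∀ z, z.1 ∈ E.X → z.2 ∈ E.W → f z ⬝ᵥ f z ≤ R) (hl : 0 < l)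
    (hfl : ∀ p, l * (p ⬝ᵥ p) ≤ ∫ z, (p ⬝ᵥ f z) ^ 2 ∂(E.Dx.prod E.unif))
    {J : Finset (ℕ × Fin n)} (hJ : J.Nonempty) :
    ∃ Z : Ω → ℝ, Integrable Z P ∧ 0 ≤ Z ∧
      ∫ ω, Z ω ∂P ≤ 4 * (R / l * Fintype.card ι) / J.card ∧
      ∀ ω, Z ω ≤ 1 → ∀ p, J.card / 2 * l * (p ⬝ᵥ p) ≤
        ∑ k ∈ J, (p ⬝ᵥ f (S.x k.1 k.2 ω, S.u k.1 k.2 ω)) ^ 2 := by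
  have := hE.prob
  have := hE.isProbabilityMeasure_unif
  have := Measure.isProbabilityMeasure_map (μ := E.Dx.prod E.unif) hf.aemeasurable
  have hxu (k : ℕ × Fin n) : Measurable fun ω => (S.x k.1 k.2 ω, S.u k.1 k.2 ω) :=
    (hS.measurable_x k.1 k.2).prodMk (hS.measurable_u k.1 k.2)
  have hbound : ∀ᵐ x ∂(E.Dx.prod E.unif).map f, x ⬝ᵥ x ≤ R := by
    refine (ae_map_iff hf.aemeasurable (measurableSet_le (by fun_prop) measurable_const)).2 ?_
    filter_upwards [ae_prod_unif_mem hE] with z hz using hR z hz.1 hz.2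
  have hsecond (p : ι → ℝ) :
      l * (p ⬝ᵥ p) ≤ ∫ x, (p ⬝ᵥ x) ^ 2 ∂(E.Dx.prod E.unif).map f := by
    rw [integral_map hf.aemeasurable (by fun_prop)]
    exact hfl p
  refine exists_eigenvalue_mul_le_sum_sq (P := P) hbound hl hsecond (fun k _ => hf.comp (hxu k))
    (fun k _ => ?_) (fun k _ k' _ hkk' => ?_) hJ
  · rw [← hS.map_feature hE k.1 k.2, Measure.map_map hf (hxu k), Function.comp_def]
  · have hfst : Measurable fun z : (Fin m → ℝ) × (Fin d → ℝ) × (Fin d → ℝ) × ℝ =>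
        f (z.1, z.2.1) := hf.comp (measurable_fst.prodMk measurable_snd.fst)
    exact (hS.indep.indepFun hkk').comp hfst hfst

lemma exists_joint_gram_bound (hS : S.IsSample P E) (hE : E.IsRegular KX KC Kμ KS) (hKS : 0 < KS)
    (hd : 1 ≤ d) (hn : 1 ≤ n) (hT₀ : 1 ≤ T₀) :
    ∃ Z : Ω → ℝ, Integrable Z P ∧ 0 ≤ Z ∧
      ∫ ω, Z ω ∂P ≤ 2 * (KX ^ 2 + 1) * ((m + d) / gramFloor KS (m + d) (n * T₀)) ∧
      ∀ ω, Z ω ≤ 1 → ∀ p, gramFloor KS (m + d) (n * T₀) * (p ⬝ᵥ p) ≤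
        ∑ k ∈ Finset.Icc 1 T₀ ×ˢ Finset.univ, (p ⬝ᵥ regressor S S.u k ω) ^ 2 := by
  have helim : Measurable fun z : (Fin m → ℝ) × (Fin d → ℝ) =>
      (Sum.elim z.1 z.2 : Fin m ⊕ Fin d → ℝ) :=
    measurable_pi_iff.2 fun j => by
      cases j <;> simp only [Sum.elim_inl, Sum.elim_inr] <;> fun_prop
  obtain ⟨Z, hZ, hZ0, hZint, hgram⟩ := hS.exists_exploration_gram_bound hE helim
    (R := KX ^ 2 + 1) (l := KS / (m + d)) (J := Finset.Icc 1 T₀ ×ˢ Finset.univ)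
    (fun z hx hu => by
      rw [sumElim_dotProduct_sumElim]
      exact add_le_add (hE.dotProduct_feature_le hx) (hE.dotProduct_action_le hu))
    (by positivity)
    (fun p => by
      rw [← Sum.elim_comp_inl_inr p]
      simpa only [sumElim_dotProduct_sumElim] using hE.eigenvalue (p ∘ Sum.inl) (p ∘ Sum.inr))
    ⟨(1, ⟨0, hn⟩), by simp [hT₀]⟩
  have hcard : ((Finset.Icc 1 T₀ ×ˢ (Finset.univ : Finset (Fin n))).card : ℝ) = n * T₀ := by
    simp [mul_comm]
  rw [hcard] at hZint hgram
  refine ⟨Z, hZ, hZ0, hZint.trans_eq ?_, hgram⟩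
  simp only [Fintype.card_sum, Fintype.card_fin, gramFloor]
  push_cast
  field_simp
  norm_num

lemma exists_action_gram_bound (hS : S.IsSample P E) (hE : E.IsRegular KX KC Kμ KS) (hKS : 0 < KS)
    (hd : 1 ≤ d) (hT₀ : 1 ≤ T₀) (i : Fin n) :
    ∃ Z : Ω → ℝ, Integrable Z P ∧ 0 ≤ Z ∧
      ∫ ω, Z ω ∂P ≤ 2 * (d / gramFloor KS (m + d) T₀) ∧
      ∀ ω, Z ω ≤ 1 → ∀ p, gramFloor KS (m + d) T₀ * (p ⬝ᵥ p) ≤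
        ∑ s ∈ Finset.Icc 1 T₀, (p ⬝ᵥ S.u s i ω) ^ 2 := by
  obtain ⟨Z, hZ, hZ0, hZint, hgram⟩ := hS.exists_exploration_gram_bound hE
    (f := Prod.snd) (R := 1) (l := KS / (m + d)) (J := Finset.Icc 1 T₀ ×ˢ {i})
    measurable_snd (fun z _ hu => hE.dotProduct_action_le hu) (by positivity)
    (fun p => by simpa using hE.eigenvalue 0 p) ⟨(1, i), by simp [hT₀]⟩
  simp only [Finset.card_product, Finset.card_singleton, Nat.card_Icc, add_tsub_cancel_right,
    mul_one, Fintype.card_fin, Finset.sum_product, Finset.sum_singleton] at hZint hgram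
  refine ⟨Z, hZ, hZ0, hZint.trans_eq ?_, hgram⟩
  unfold gramFloor
  field_simp
  norm_num

end Primitives.IsSample

/-- Bound for the expected error of a regularized least squares estimate: `D` is the number of
parameters, `B` bounds the norm of the regressors, `N` the eigenvalues of the Gram matrix from below
and `g` the expected noise. The first term is the scale below which errors are neglected, and in the
last one the trivial bound `K` is paid on the event that the Gram matrix is degenerate. -/
def errorBudget (τ B ε K g D N : ℝ) : ℝ :=
  ε * B + 2 * τ * B / (ε * N) * g + K * (2 * B ^ 2 * (D / N))

lemma exists_integrable_le_or_le [IsProbabilityMeasure P] {G Z : Ω → ℝ} {a c g ζ K : ℝ}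
    (hG : Integrable G P) (hG0 : ∀ᵐ ω ∂P, 0 ≤ G ω) (hg : ∫ ω, G ω ∂P ≤ g) (hZ : Integrable Z P)
    (hZ0 : 0 ≤ Z) (hζ : ∫ ω, Z ω ∂P ≤ ζ) (ha : 0 ≤ a) (hc : 0 ≤ c) (hK : 0 ≤ K) :
    ∃ R : Ω → ℝ, Integrable R P ∧ ∫ ω, R ω ∂P ≤ a + c * g + K * ζ ∧
      ∀ᵐ ω ∂P, 0 ≤ R ω ∧ (K ≤ R ω ∨ Z ω ≤ 1 ∧ a + c * G ω ≤ R ω) := by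
  have haG : Integrable (fun ω => a + c * G ω) P := (integrable_const a).add (hG.const_mul c)
  refine ⟨fun ω => a + c * G ω + K * Z ω, haG.add (hZ.const_mul K), ?_, ?_⟩
  · rw [integral_add haG (hZ.const_mul K), integral_add (integrable_const a) (hG.const_mul c),
      integral_const_mul, integral_const_mul]
    simp only [integral_const, probReal_univ, one_smul]
    gcongr
  · filter_upwards [hG0] with ω hω
    have hKZ := mul_nonneg hK (hZ0 ω)
    have hcG := mul_nonneg hc hω
    refine ⟨by positivity, (le_total (Z ω) 1).symm.imp (fun h => ?_) fun h => ⟨h, by linarith⟩⟩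
    linarith [mul_le_mul_of_nonneg_left h hK]

namespace IsRun

lemma ae_mem (hrun : IsRun E S w b γ T₀ T) (hS : S.IsSample P E)
    (hE : E.IsRegular KX KC Kμ KS) :
    ∀ᵐ ω ∂P, ∀ t ≤ T, ∀ i, S.x t i ω ∈ E.X ∧ w t i ω ∈ E.W := by
  filter_upwards [hS.ae_mem hE] with ω hω t ht i
  exact ⟨(hω t i).1, hrun.action_mem ht i (hω t i).2⟩

variable [IsProbabilityMeasure P]

lemma exists_label_noise_bound (hrun : IsRun E S w b γ T₀ T) (hS : S.IsSample P E)
    (hE : E.IsRegular KX KC Kμ KS) (hd : 1 ≤ d) (hn : 1 ≤ n) {t : ℕ} (ht₀ : 0 < t)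
    (ht : t ≤ T) :
    ∃ G : Ω → ℝ, Integrable G P ∧
      ∫ ω, G ω ∂P ≤ noiseBudget E.tau √(KX ^ 2 + 1) (m + d) (n * T) ∧
      ∀ᵐ ω ∂P, ∀ (p : Fin m ⊕ Fin d → ℝ) (v : Fin d → ℝ), p ⬝ᵥ p ≤ 1 → v ⬝ᵥ v ≤ 1 →
        ∑ k ∈ Finset.range t ×ˢ Finset.univ,
          compensated E.tau p v (regressor S w k ω) (S.e k.1 k.2 ω) ≤ G ω := by
  have hround {k : ℕ × Fin n} (hk : k ∈ Finset.range t ×ˢ Finset.univ) : k.1 ≤ T :=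
    (Finset.mem_range.1 (Finset.mem_product.1 hk).1).le.trans ht
  obtain ⟨G, hG, hGint, hGle⟩ := hS.exists_noise_bound hE hd
    (z := fun t i => regressor S w (t, i)) (J := Finset.range t ×ˢ Finset.univ) (N := n * T)
    (by simp) (fun k hk => hrun.measurable_regressor (hround hk)) (Real.sqrt_nonneg (KX ^ 2 + 1))
    (by
      filter_upwards [hrun.ae_mem hS hE] with ω hω k hk
      obtain ⟨hx, hw⟩ := hω k.1 (hround hk) k.2
      exact regressor_dotProduct_self_le hE hx hw)
    (Nat.mul_pos hn (ht₀.trans_le ht)) (by simpa [mul_comm] using Nat.mul_le_mul_left n ht)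
  refine ⟨G, hG, by simpa using hGint, ?_⟩
  filter_upwards [hGle] with ω hω p v hp hv
  simpa only [compensated_elim_zero_noise] using hω p (Sum.elim v 0) hp (by simpa using hv)

lemma exists_bandit_noise_bound (hrun : IsRun E S w b γ T₀ T) (hS : S.IsSample P E)
    (hE : E.IsRegular KX KC Kμ KS) (hd : 1 ≤ d) (i : Fin n) {t : ℕ} (ht₀ : 0 < t) (ht : t ≤ T) :
    ∃ G : Ω → ℝ, Integrable G P ∧ ∫ ω, G ω ∂P ≤ noiseBudget E.tau 1 d T ∧
      ∀ᵐ ω ∂P, ∀ p : Fin d → ℝ, p ⬝ᵥ p ≤ 1 → ∑ s ∈ Finset.Ico 1 t,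
        compensated E.tau p 1 (w s i ω) (fun _ : Unit => S.η s i ω) ≤ G ω := by
  have hround {k : ℕ × Fin n} (hk : k ∈ Finset.Ico 1 t ×ˢ {i}) : k.1 ≤ T :=
    (Finset.mem_Ico.1 (Finset.mem_product.1 hk).1).2.le.trans ht
  obtain ⟨G, hG, hGint, hGle⟩ := hS.exists_noise_bound hE hd (z := w)
    (J := Finset.Ico 1 t ×ˢ {i}) (N := T) (by simp) (fun k hk => hrun.adapted k.1 (hround hk) k.2)
    zero_le_one
    (by
      filter_upwards [hrun.ae_mem hS hE] with ω hω k hk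
      simpa using hE.dotProduct_action_le (hω k.1 (hround hk) k.2).2)
    (ht₀.trans_le ht) (by simpa using (Nat.sub_le t 1).trans ht)
  refine ⟨G, hG, by simpa using hGint, ?_⟩
  filter_upwards [hGle] with ω hω p hp
  simpa only [compensated_zero_elim_noise, Finset.sum_product, Finset.sum_singleton] using
    hω p (Sum.elim 0 1) hp (by simp)

lemma exists_label_error_bound (hrun : IsRun E S w b γ T₀ T) (hS : S.IsSample P E)
    (hE : E.IsRegular KX KC Kμ KS) (hKS : 0 < KS) (hd : 1 ≤ d) (hn : 1 ≤ n) (hT₀ : 1 ≤ T₀)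
    {t : ℕ} (ht₀ : T₀ < t) (ht : t ≤ T) {ε K : ℝ} (hε : 0 < ε) (hε1 : ε ≤ 1) (hK : 0 ≤ K) :
    ∃ R : Ω → ℝ, Integrable R P ∧
      ∫ ω, R ω ∂P ≤ errorBudget E.tau √(KX ^ 2 + 1) ε K
        (noiseBudget E.tau √(KX ^ 2 + 1) (m + d) (n * T)) (m + d)
        (gramFloor KS (m + d) (n * T₀)) ∧
      ∀ᵐ ω ∂P, 0 ≤ R ω ∧ (K ≤ R ω ∨ ∀ F' G', IsOLS E S w t ω F' G' →
        ∀ x ∈ E.X, ∀ u ∈ E.W, |u ⬝ᵥ ((F' - E.F) *ᵥ x + (G' - E.G) *ᵥ u)| ≤ R ω) := by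
  have hN : 0 < gramFloor KS (m + d) (n * T₀) := gramFloor_pos hKS (by positivity) (by positivity)
  have hτ := E.one_le_tau
  obtain ⟨G, hG, hGint, hGle⟩ := hrun.exists_label_noise_bound hS hE hd hn (hT₀.trans ht₀.le) ht
  obtain ⟨Z, hZ, hZ0, hZint, hgram⟩ := hS.exists_joint_gram_bound hE hKS hd hn hT₀
  have hG0 : ∀ᵐ ω ∂P, 0 ≤ G ω := by
    filter_upwards [hGle] with ω hω
    simpa [compensated] using hω 0 0 (by simp) (by simp)
  obtain ⟨R, hR, hRint, hRle⟩ := exists_integrable_le_or_le (a := ε * √(KX ^ 2 + 1)) (K := K)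
    hG hG0 hGint hZ hZ0 hZint
    (by positivity) (by positivity : 0 ≤ 2 * E.tau * √(KX ^ 2 + 1) /
      (ε * gramFloor KS (m + d) (n * T₀))) hK
  refine ⟨R, hR, ?_, ?_⟩
  · rwa [errorBudget, Real.sq_sqrt (by positivity)]
  filter_upwards [hRle, hGle, hG0] with ω hRω hGω hG0ω
  refine ⟨hRω.1, hRω.2.imp_right ?_⟩
  rintro ⟨hZω, hRω⟩ F' G' hols x hx u hu
  calc |u ⬝ᵥ ((F' - E.F) *ᵥ x + (G' - E.G) *ᵥ u)|
      ≤ (ε + 2 * E.tau * G ω / (ε * gramFloor KS (m + d) (n * T₀))) * √(x ⬝ᵥ x + u ⬝ᵥ u) :=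
        hols.abs_error_le hε hε1 hN
          (fun p => (hgram ω hZω p).trans (hrun.sum_sq_exploration_le ht₀ ht p ω))
          (fun p hp => hGω p u hp (hE.dotProduct_action_le hu)) x u
    _ ≤ (ε + 2 * E.tau * G ω / (ε * gramFloor KS (m + d) (n * T₀))) * √(KX ^ 2 + 1) := by
        gcongr
        · exact hE.dotProduct_feature_le hx
        · exact hE.dotProduct_action_le hu
    _ = _ := by ring
    _ ≤ R ω := hRω

lemma exists_bandit_error_bound (hrun : IsRun E S w b γ T₀ T) (hS : S.IsSample P E)
    (hE : E.IsRegular KX KC Kμ KS) (hKS : 0 < KS) (hd : 1 ≤ d) (i : Fin n) (hT₀ : 1 ≤ T₀)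
    {t : ℕ} (ht₀ : T₀ < t) (ht : t ≤ T) {ε K : ℝ} (hε : 0 < ε) (hε1 : ε ≤ 1) (hK : 0 ≤ K) :
    ∃ R : Ω → ℝ, Integrable R P ∧
      ∫ ω, R ω ∂P ≤ √(radius d n γ t / gramFloor KS (m + d) T₀) +
        errorBudget E.tau 1 ε K (noiseBudget E.tau 1 d T + d * (Kμ ^ 2 / 2)) d
          (gramFloor KS (m + d) T₀) ∧
      ∀ᵐ ω ∂P, 0 ≤ R ω ∧ (K ≤ R ω ∨
        ∀ ν ∈ confBall E S w b γ t i ω, ∀ u ∈ E.W, |(ν - E.μ) ⬝ᵥ u| ≤ R ω) := by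
  have hN : 0 < gramFloor KS (m + d) T₀ := gramFloor_pos hKS (by positivity) (by positivity)
  have hτ := E.one_le_tau
  obtain ⟨G, hG, hGint, hGle⟩ := hrun.exists_bandit_noise_bound hS hE hd i (hT₀.trans ht₀.le) ht
  obtain ⟨Z, hZ, hZ0, hZint, hgramFloor⟩ := hS.exists_action_gram_bound hE hKS hd hT₀ i
  have hG0 : ∀ᵐ ω ∂P, 0 ≤ G ω := by
    filter_upwards [hGle] with ω hω
    simpa [compensated] using hω 0 (by simp)
  have hprior : 0 ≤ d * (Kμ ^ 2 / 2) := by positivity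
  obtain ⟨R, hR, hRint, hRle⟩ := exists_integrable_le_or_le (K := K)
    (a := √(radius d n γ t / gramFloor KS (m + d) T₀) + ε)
    (c := 2 * E.tau / (ε * gramFloor KS (m + d) T₀))
    (g := noiseBudget E.tau 1 d T + d * (Kμ ^ 2 / 2))
    (hG.add (integrable_const (d * (Kμ ^ 2 / 2)))) (hG0.mono fun ω h => add_nonneg h hprior)
    (by
      rw [integral_add' hG (integrable_const _)]
      simpa using hGint)
    hZ hZ0 hZint (by positivity) (by positivity) hK
  refine ⟨R, hR, hRint.trans_eq (by unfold errorBudget; ring), ?_⟩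
  filter_upwards [hRle, hGle] with ω hRω hGω
  refine ⟨hRω.1, hRω.2.imp_right ?_⟩
  rintro ⟨hZω, hRω⟩ ν hν u hu
  have hgram (p : Fin d → ℝ) :=
    (hgramFloor ω hZω p).trans (hrun.sum_sq_exploration_le_gram ht₀ ht i p ω)
  calc |(ν - E.μ) ⬝ᵥ u|
      ≤ (l2norm (ν - muHat E S w b t i ω) + l2norm (muHat E S w b t i ω - E.μ)) * √(u ⬝ᵥ u) := by
        rw [← sub_add_sub_cancel ν (muHat E S w b t i ω), add_dotProduct, add_mul]
        exact (abs_add_le _ _).trans (add_le_add (abs_dotProduct_le_sqrt_mul_sqrt _ _)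
          (abs_dotProduct_le_sqrt_mul_sqrt _ _))
    _ ≤ l2norm (ν - muHat E S w b t i ω) + l2norm (muHat E S w b t i ω - E.μ) :=
        mul_le_of_le_one_right (add_nonneg (Real.sqrt_nonneg _) (Real.sqrt_nonneg _))
          (Real.sqrt_le_one.2 (hE.dotProduct_action_le hu))
    _ ≤ _ := add_le_add (l2norm_sub_muHat_le hN hgram hν)
        (l2norm_muHat_sub_le hE (fun j => hrun.spanner.1 j) hε hε1 hN hgram hGω)
    _ = _ := by simp only [Pi.add_apply]; ring
    _ ≤ R ω := hRω

end IsRun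

end Run

/-! ### The excess cost of a round -/

section ExcessCost

variable {m d n : ℕ} {Ω : Type*} {S : Primitives m d n Ω} {E : Env m d} {KX KC Kμ KS : ℝ}
  {w : ℕ → Fin n → Ω → (Fin d → ℝ)} {b : Fin d → Fin d → ℝ} {γ : ℝ} {T₀ T t : ℕ}
  {π : (Fin m → ℝ) → (Fin d → ℝ)}

namespace Env

/-- The amount by which the conditional expected cost, given the feature `x`, of action `v` exceeds
that of action `v'`. -/
def gap (E : Env m d) (x : Fin m → ℝ) (v v' : Fin d → ℝ) : ℝ :=
  (E.F *ᵥ x + E.G *ᵥ v + E.μ) ⬝ᵥ v - (E.F *ᵥ x + E.G *ᵥ v' + E.μ) ⬝ᵥ v'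

lemma cost_sub_cost (x : Fin m → ℝ) (e : Fin d → ℝ) (h : ℝ) (v v' : Fin d → ℝ) :
    E.cost x e h v - E.cost x e h v' = E.gap x v v' + ∑ j, e j * (v j - v' j) := by
  have hnoise : ∑ j, e j * (v j - v' j) = e ⬝ᵥ v - e ⬝ᵥ v' := (dotProduct_sub e v v')
  rw [hnoise]
  simp only [cost, gap, label, add_dotProduct]
  ring

lemma IsRegular.abs_gap_le (hE : E.IsRegular KX KC Kμ KS) {x : Fin m → ℝ} (hx : x ∈ E.X)
    {v v' : Fin d → ℝ} (hv : v ∈ E.W) (hv' : v' ∈ E.W) :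
    |E.gap x v v'| ≤ 2 * (|KC| + |Kμ|) := by
  have hdot {a u : Fin d → ℝ} {r : ℝ} (ha : l2norm a ≤ r) (hu : u ∈ E.W) : |a ⬝ᵥ u| ≤ |r| :=
    (abs_dotProduct_le_sqrt_mul_sqrt a u).trans ((mul_le_of_le_one_right (Real.sqrt_nonneg _)
      (hE.norm_action u hu)).trans (ha.trans (le_abs_self r)))
  have hcost {u : Fin d → ℝ} (hu : u ∈ E.W) :
      |(E.F *ᵥ x + E.G *ᵥ u + E.μ) ⬝ᵥ u| ≤ |KC| + |Kμ| := by
    rw [add_dotProduct]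
    exact (abs_add_le _ _).trans
      (add_le_add (hdot (hE.norm_label x hx u hu) hu) (hdot hE.norm_mu hu))
  exact (abs_sub _ _).trans ((add_le_add (hcost hv) (hcost hv')).trans_eq (two_mul _).symm)

lemma measurable_gap {α : Type*} [MeasurableSpace α] {x : α → Fin m → ℝ} {v v' : α → Fin d → ℝ}
    (hx : Measurable x) (hv : Measurable v) (hv' : Measurable v') :
    Measurable fun a => E.gap (x a) (v a) (v' a) := by
  have hmulVec {k : ℕ} (M : Matrix (Fin d) (Fin k) ℝ) {f : α → Fin k → ℝ} (hf : Measurable f) :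
      Measurable fun a => M *ᵥ f a :=
    measurable_pi_iff.2 fun j => measurable_dotProduct measurable_const hf
  have hlabel {u : α → Fin d → ℝ} (hu : Measurable u) :
      Measurable fun a => E.F *ᵥ x a + E.G *ᵥ u a + E.μ :=
    ((hmulVec E.F hx).add (hmulVec E.G hu)).add_const E.μ
  exact (measurable_dotProduct (hlabel hv) hv).sub (measurable_dotProduct (hlabel hv') hv')

lemma gap_le_of_isOptimisticChoice {F' : Matrix (Fin d) (Fin m) ℝ} {G' : Matrix (Fin d) (Fin d) ℝ}
    {B : Set (Fin d → ℝ)} {x : Fin m → ℝ} {v v' : Fin d → ℝ}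
    (h : IsOptimisticChoice E.W B (fun u => F' *ᵥ x + G' *ᵥ u) v) (hv' : v' ∈ E.W) {r₁ r₂ : ℝ}
    (hlabel : ∀ u ∈ E.W, |u ⬝ᵥ ((F' - E.F) *ᵥ x + (G' - E.G) *ᵥ u)| ≤ r₁)
    (hbandit : ∀ ν ∈ B, ∀ u ∈ E.W, |(ν - E.μ) ⬝ᵥ u| ≤ r₂) :
    E.gap x v v' ≤ 2 * (r₁ + r₂) := by
  refine sub_le_iff_le_add'.2 (h.le_add (c := fun u => E.F *ᵥ x + E.G *ᵥ u + E.μ) hv'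
    fun u hu ν hν => ?_)
  have hsplit : (F' *ᵥ x + G' *ᵥ u + ν) ⬝ᵥ u - (E.F *ᵥ x + E.G *ᵥ u + E.μ) ⬝ᵥ u =
      u ⬝ᵥ ((F' - E.F) *ᵥ x + (G' - E.G) *ᵥ u) + (ν - E.μ) ⬝ᵥ u := by
    rw [dotProduct_comm u]
    simp only [Matrix.sub_mulVec, add_dotProduct, sub_dotProduct]
    ring
  rw [hsplit]
  exact (abs_add_le _ _).trans (add_le_add (hlabel u hu) (hbandit ν hν u hu))

end Env

namespace IsRun

lemma measurable_action_sub (hrun : IsRun E S w b γ T₀ T) (hπ : Measurable π) (ht : t ≤ T)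
    (i : Fin n) (j : Fin d) : Measurable[S.info t] fun ω => w t i ω j - π (S.x t i ω) j :=
  ((measurable_pi_apply j).comp (hrun.adapted t ht i)).sub
    ((measurable_pi_apply j).comp (hπ.comp (Primitives.measurable_x_info t i)))

variable [MeasurableSpace Ω] {P : Measure Ω} (hrun : IsRun E S w b γ T₀ T)
  (hS : S.IsSample P E) (hE : E.IsRegular KX KC Kμ KS)
  (hπ : Measurable π) (hπW : ∀ x ∈ E.X, π x ∈ E.W)
include hrun hS hE hπ hπW

section Round

variable (ht : t ≤ T) (i : Fin n)
include ht

omit hπ in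
lemma ae_abs_gap_le :
    ∀ᵐ ω ∂P, |E.gap (S.x t i ω) (w t i ω) (π (S.x t i ω))| ≤ 2 * (|KC| + |Kμ|) := by
  filter_upwards [hrun.ae_mem hS hE] with ω hω
  obtain ⟨hx, hw⟩ := hω t ht i
  exact hE.abs_gap_le hx hw (hπW _ hx)

lemma integrable_noise_mul_action_sub (j : Fin d) :
    Integrable (fun ω => S.e t i ω j * (w t i ω j - π (S.x t i ω) j)) P := by
  have haction : Measurable fun ω => w t i ω j - π (S.x t i ω) j :=
    (hrun.measurable_action_sub hπ ht i j).mono (hS.info_le t) le_rfl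
  have hcoord {u : Fin d → ℝ} (hu : u ∈ E.W) : |u j| ≤ 1 :=
    abs_le_of_dotProduct_self_le zero_le_one (by simpa using hE.dotProduct_action_le hu) j
  refine (hS.integrable_noise_apply hE t i (Sum.inl j)).mul_bdd (c := 1 + 1)
    haction.aestronglyMeasurable ?_
  filter_upwards [hrun.ae_mem hS hE] with ω hω
  obtain ⟨hx, hw⟩ := hω t ht i
  exact (abs_sub _ _).trans (add_le_add (hcoord hw) (hcoord (hπW _ hx)))

variable [IsProbabilityMeasure P]

lemma integrable_gap : Integrable (fun ω => E.gap (S.x t i ω) (w t i ω) (π (S.x t i ω))) P :=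
  .of_bound (Env.measurable_gap (hS.measurable_x t i) ((hrun.adapted t ht i).mono (hS.info_le t)
    le_rfl) (hπ.comp (hS.measurable_x t i))).aestronglyMeasurable _
    (hrun.ae_abs_gap_le hS hE hπW ht i)

omit hπW in
lemma indepFun_noise_action_sub (j : Fin d) :
    IndepFun (fun ω => S.e t i ω j) (fun ω => w t i ω j - π (S.x t i ω) j) P := by
  have haction := hrun.measurable_action_sub hπ ht i j
  have hnoise : Measurable[MeasurableSpace.comap (S.noise t i) inferInstance]
      fun ω => S.e t i ω j :=
    (measurable_pi_apply (Sum.inl j)).comp (comap_measurable (S.noise t i))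
  exact (indep_of_indep_of_le_right (indep_of_indep_of_le_left (hS.indep_others_noise hE t i)
    (haction.comap_le.trans (Primitives.info_le_others t i))) hnoise.comap_le).symm

omit hπW in
lemma integral_noise_mul_action_sub (j : Fin d) :
    ∫ ω, S.e t i ω j * (w t i ω j - π (S.x t i ω) j) ∂P = 0 := by
  have haction : Measurable fun ω => w t i ω j - π (S.x t i ω) j :=
    (hrun.measurable_action_sub hπ ht i j).mono (hS.info_le t) le_rfl
  have hmean : ∫ ω, S.e t i ω j ∂P = 0 := hS.integral_noise_apply hE t i (Sum.inl j)
  rw [(hrun.indepFun_noise_action_sub hS hE hπ ht i j).integral_fun_mul_eq_mul_integral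
    ((measurable_pi_apply j).comp (hS.measurable_e t i)).aestronglyMeasurable
    haction.aestronglyMeasurable, hmean, zero_mul]

lemma integrable_cost_sub :
    Integrable (fun ω => E.cost (S.x t i ω) (S.e t i ω) (S.η t i ω) (w t i ω) -
      E.cost (S.x t i ω) (S.e t i ω) (S.η t i ω) (π (S.x t i ω))) P := by
  simp only [Env.cost_sub_cost]
  exact (hrun.integrable_gap hS hE hπ hπW ht i).add
    (integrable_finsetSum _ fun j _ => hrun.integrable_noise_mul_action_sub hS hE hπ hπW ht i j)

lemma integral_cost_sub :
    ∫ ω, (E.cost (S.x t i ω) (S.e t i ω) (S.η t i ω) (w t i ω) -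
      E.cost (S.x t i ω) (S.e t i ω) (S.η t i ω) (π (S.x t i ω))) ∂P =
    ∫ ω, E.gap (S.x t i ω) (w t i ω) (π (S.x t i ω)) ∂P := by
  have hnoise := hrun.integrable_noise_mul_action_sub hS hE hπ hπW ht i
  simp only [Env.cost_sub_cost]
  rw [integral_add (hrun.integrable_gap hS hE hπ hπW ht i)
      (integrable_finsetSum _ fun j _ => hnoise j),
    integral_finsetSum _ fun j _ => hnoise j,
    Finset.sum_eq_zero fun j _ => hrun.integral_noise_mul_action_sub hS hE hπ ht i j, add_zero]

lemma integral_gap_le :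
    ∫ ω, E.gap (S.x t i ω) (w t i ω) (π (S.x t i ω)) ∂P ≤ 2 * (|KC| + |Kμ|) := by
  simpa using integral_mono_ae (hrun.integrable_gap hS hE hπ hπW ht i) (integrable_const _)
    ((hrun.ae_abs_gap_le hS hE hπW ht i).mono fun ω hω => (le_abs_self _).trans hω)

lemma integral_gap_exploit_le (hKS : 0 < KS) (hd : 1 ≤ d) (hn : 1 ≤ n) (hT₀ : 1 ≤ T₀)
    (ht₀ : T₀ < t) {ε : ℝ} (hε : 0 < ε) (hε1 : ε ≤ 1) :
    ∫ ω, E.gap (S.x t i ω) (w t i ω) (π (S.x t i ω)) ∂P ≤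
      2 * (errorBudget E.tau √(KX ^ 2 + 1) ε (|KC| + |Kμ|)
          (noiseBudget E.tau √(KX ^ 2 + 1) (m + d) (n * T)) (m + d)
          (gramFloor KS (m + d) (n * T₀)) +
        (√(radius d n γ t / gramFloor KS (m + d) T₀) +
          errorBudget E.tau 1 ε (|KC| + |Kμ|) (noiseBudget E.tau 1 d T + d * (Kμ ^ 2 / 2)) d
            (gramFloor KS (m + d) T₀))) := by
  have hK : 0 ≤ |KC| + |Kμ| := by positivity
  obtain ⟨R₁, hR₁, hR₁int, hlabel⟩ :=
    hrun.exists_label_error_bound hS hE hKS hd hn hT₀ ht₀ ht hε hε1 hK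
  obtain ⟨R₂, hR₂, hR₂int, hbandit⟩ :=
    hrun.exists_bandit_error_bound hS hE hKS hd i hT₀ ht₀ ht hε hε1 hK
  have hgap : ∀ᵐ ω ∂P, E.gap (S.x t i ω) (w t i ω) (π (S.x t i ω)) ≤ 2 * (R₁ ω + R₂ ω) := by
    filter_upwards [hlabel, hbandit, hrun.ae_mem hS hE, hrun.ae_abs_gap_le hS hE hπW ht i]
      with ω ⟨hR₁0, hlabelω⟩ ⟨hR₂0, hbanditω⟩ hmem hgapω
    have hx := (hmem t ht i).1
    rcases hlabelω with hbad | hlabelω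
    · linarith [le_abs_self (E.gap (S.x t i ω) (w t i ω) (π (S.x t i ω)))]
    rcases hbanditω with hbad | hbanditω
    · linarith [le_abs_self (E.gap (S.x t i ω) (w t i ω) (π (S.x t i ω)))]
    obtain ⟨F', G', hols, hchoice⟩ := hrun.exploit t ht₀ ht ω
    exact Env.gap_le_of_isOptimisticChoice (hchoice i) (hπW _ hx)
      (hlabelω F' G' hols (S.x t i ω) hx) hbanditω
  have hmono := integral_mono_ae (hrun.integrable_gap hS hE hπ hπW ht i)
    ((hR₁.add hR₂).const_mul 2) hgap
  rw [integral_const_mul, integral_add' hR₁ hR₂] at hmono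
  exact hmono.trans (by gcongr)

end Round

variable [IsProbabilityMeasure P]

lemma integrable_excessCost : Integrable (excessCost E S w π T) P :=
  integrable_finsetSum _ fun _ ht => integrable_finsetSum _ fun i _ =>
    hrun.integrable_cost_sub hS hE hπ hπW (Finset.mem_Icc.1 ht).2 i

lemma regret_eq_sum_integral_gap :
    regret E S w P π T = ∑ t ∈ Finset.Icc 1 T, ∑ i,
      ∫ ω, E.gap (S.x t i ω) (w t i ω) (π (S.x t i ω)) ∂P := by
  have hcost {t : ℕ} (ht : t ∈ Finset.Icc 1 T) (i : Fin n) :=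
    hrun.integrable_cost_sub hS hE hπ hπW (Finset.mem_Icc.1 ht).2 i
  unfold regret excessCost
  rw [integral_finsetSum _ fun t ht => integrable_finsetSum _ fun i _ => hcost ht i]
  refine Finset.sum_congr rfl fun t ht => ?_
  rw [integral_finsetSum _ fun i _ => hcost ht i]
  exact Finset.sum_congr rfl fun i _ =>
    hrun.integral_cost_sub hS hE hπ hπW (Finset.mem_Icc.1 ht).2 i

end IsRun

end ExcessCost

/-! ### Balancing exploration and exploitation -/

section Rate

variable {m d n T T₀ t : ℕ} {γ KX KC Kμ KS κ τ : ℝ}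

/-- The optimal exploration length, which balances the cost of exploring against the estimation
errors that remain afterwards. -/
def rate (m d T : ℕ) : ℝ := (m : ℝ) ^ (1 / 3 : ℝ) * (d : ℝ) ^ (2 / 3 : ℝ) * (T : ℝ) ^ (2 / 3 : ℝ)

lemma rate_nonneg (m d T : ℕ) : 0 ≤ rate m d T := by unfold rate; positivity

lemma rate_pow_three (m d T : ℕ) : rate m d T ^ 3 = m * d ^ 2 * T ^ 2 := by
  have hpow (x : ℕ) (r : ℝ) : ((x : ℝ) ^ r) ^ 3 = (x : ℝ) ^ (r * 3) := by
    rw [← Real.rpow_natCast, ← Real.rpow_mul x.cast_nonneg]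
    norm_num
  rw [rate, mul_pow, mul_pow, hpow, hpow, hpow]
  norm_num

lemma rate_mul_div_sq (hT : 1 ≤ T) : rate m d T * (rate m d T / T) ^ 2 = m * d ^ 2 := by
  rw [div_pow, ← mul_div_assoc, ← pow_succ', rate_pow_three,
    mul_div_cancel_right₀ _ (by positivity)]

lemma mul_sq_le_of_eight_mul_rate_le (hT : 1 ≤ T) (hlong : 8 * rate m d T ≤ T) :
    512 * (m * d ^ 2 : ℝ) ≤ T := by
  have hcube := pow_le_pow_left₀ (mul_nonneg (by norm_num) (rate_nonneg m d T)) hlong 3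
  rw [mul_pow, rate_pow_three] at hcube
  have hT' : (0 : ℝ) < T ^ 2 := by positivity
  exact le_of_mul_le_mul_right (by linarith) hT'

lemma one_le_natCast_mul_sq (hm : 1 ≤ m) (hd : 1 ≤ d) : (1 : ℝ) ≤ m * d ^ 2 :=
  one_le_mul_of_one_le_of_one_le (by exact_mod_cast hm)
    (one_le_pow₀ (by exact_mod_cast hd))

lemma two_le_rate (hm : 1 ≤ m) (hd : 1 ≤ d) (hT : 1 ≤ T) (hlong : 8 * rate m d T ≤ T) :
    2 ≤ rate m d T := by
  refine le_of_pow_le_pow_left₀ three_ne_zero (rate_nonneg m d T) ?_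
  have hmd := one_le_natCast_mul_sq hm hd
  have hT' := mul_sq_le_of_eight_mul_rate_le hT hlong
  rw [rate_pow_three]
  nlinarith

lemma dim_le_of_eight_mul_rate_le (hm : 1 ≤ m) (hd : 1 ≤ d) (hT : 1 ≤ T)
    (hlong : 8 * rate m d T ≤ T) : m + d ≤ T := by
  have hle := mul_sq_le_of_eight_mul_rate_le hT hlong
  have hle' : 512 * (m * d ^ 2) ≤ T := by exact_mod_cast hle
  nlinarith [Nat.mul_le_mul hm hd, Nat.le_mul_of_pos_right m (by positivity : 0 < d ^ 2),
    Nat.le_mul_of_pos_left (d ^ 2) hm]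

lemma half_rate_le (hm : 1 ≤ m) (hd : 1 ≤ d) (hT : 1 ≤ T) (hlong : 8 * rate m d T ≤ T)
    (hT₀ : |(T₀ : ℝ) - rate m d T| < 1) : rate m d T / 2 ≤ T₀ := by
  linarith [two_le_rate hm hd hT hlong, (abs_lt.1 hT₀).1]

lemma div_gramFloor_le {D D' k A x : ℝ} (hKS : 0 < KS) (hD : 0 < D) (hk : 0 < k)
    (h : D' * D ≤ A * k * x) : D' / gramFloor KS D k ≤ 2 * A / KS * x := by
  rw [div_le_iff₀ (gramFloor_pos hKS hD hk)]
  calc D' = D' * D / D := by field_simp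
    _ ≤ A * k * x / D := by gcongr
    _ = 2 * A / KS * x * gramFloor KS D k := by
      unfold gramFloor
      field_simp

lemma dim_div_label_gramFloor_le (hKS : 0 < KS) (hm : 1 ≤ m) (hd : 1 ≤ d) (hn : 1 ≤ n)
    (hT : 1 ≤ T) (hT₀ : 1 ≤ T₀) (hκ : (m : ℝ) ≤ κ * n) (hhalf : rate m d T / 2 ≤ T₀) :
    (m + d : ℝ) / gramFloor KS (m + d) (n * T₀) ≤
      2 * (4 * (κ + 1)) / KS * (rate m d T / T) ^ 2 := by
  refine div_gramFloor_le hKS (by positivity) (by positivity) ?_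
  have hm' : (1 : ℝ) ≤ m := by exact_mod_cast hm
  have hd' : (1 : ℝ) ≤ d := by exact_mod_cast hd
  have hn' : (1 : ℝ) ≤ n := by exact_mod_cast hn
  have hκn : 0 ≤ κ * n := m.cast_nonneg.trans hκ
  calc (m + d : ℝ) * (m + d) ≤ 2 * (m * m + d ^ 2) := by linarith [two_mul_le_add_sq (m : ℝ) d]
    _ ≤ 2 * (κ * n * (m * d ^ 2) + n * (m * d ^ 2)) := by
      gcongr ?_ * (?_ + ?_)
      · exact mul_le_mul hκ (le_mul_of_one_le_right m.cast_nonneg (one_le_pow₀ hd'))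
          m.cast_nonneg hκn
      · rw [← mul_assoc]
        exact le_mul_of_one_le_left (sq_nonneg _) (one_le_mul_of_one_le_of_one_le hn' hm')
    _ = 2 * (κ * n + n) * rate m d T * (rate m d T / T) ^ 2 := by
      rw [← rate_mul_div_sq hT]
      ring
    _ ≤ 2 * (κ * n + n) * (2 * T₀) * (rate m d T / T) ^ 2 := by
      gcongr
      linarith
    _ = 4 * (κ + 1) * (n * T₀) * (rate m d T / T) ^ 2 := by ring

lemma dim_div_bandit_gramFloor_le (hKS : 0 < KS) (hm : 1 ≤ m) (hd : 1 ≤ d) (hT : 1 ≤ T)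
    (hT₀ : 1 ≤ T₀) (hhalf : rate m d T / 2 ≤ T₀) :
    (d : ℝ) / gramFloor KS (m + d) T₀ ≤ 2 * 4 / KS * (rate m d T / T) ^ 2 := by
  refine div_gramFloor_le hKS (by positivity) (by positivity) ?_
  have hm' : (1 : ℝ) ≤ m := by exact_mod_cast hm
  have hd' : (1 : ℝ) ≤ d := by exact_mod_cast hd
  calc (d : ℝ) * (m + d) ≤ d * (2 * (m * d)) := by
        gcongr
        nlinarith
    _ = 2 * rate m d T * (rate m d T / T) ^ 2 := by
      rw [mul_assoc, rate_mul_div_sq hT]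
      ring
    _ ≤ 2 * (2 * T₀) * (rate m d T / T) ^ 2 := by
      gcongr
      linarith
    _ = 4 * T₀ * (rate m d T / T) ^ 2 := by ring

/-- The logarithmic factor of the regret bound. -/
def logFactor (n T : ℕ) (γ : ℝ) : ℝ := 1 + Real.log (n * T / γ)

lemma log_natCast_mul_add_one_le_logFactor (hn : 1 ≤ n) (hT : 1 ≤ T) (hγ : 0 < γ) (hγ1 : γ ≤ 1) :
    Real.log (n * T) + 1 ≤ logFactor n T γ := by
  rw [logFactor, add_comm]
  gcongr
  exact le_div_self (by positivity) hγ hγ1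

lemma one_le_logFactor (hn : 1 ≤ n) (hT : 1 ≤ T) (hγ : 0 < γ) (hγ1 : γ ≤ 1) :
    1 ≤ logFactor n T γ := by
  have hlog : 0 ≤ Real.log (n * T) := by exact_mod_cast Real.log_natCast_nonneg (n * T)
  linarith [log_natCast_mul_add_one_le_logFactor hn hT hγ hγ1]

lemma log_two_mul_sq_mul_add_one_le {D N : ℕ} (hn : 1 ≤ n) (hT : 1 ≤ T) (hγ : 0 < γ)
    (hγ1 : γ ≤ 1) (hDT : D ≤ T) (hN : N ≤ n * T) :
    Real.log (2 * (D ^ 2 * N) + 1) ≤ 3 * logFactor n T γ := by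
  have hnT : 0 < n * T := Nat.mul_pos hn hT
  have hpoly : 2 * (D ^ 2 * N) + 1 ≤ 3 * (n * T) ^ 3 := by
    have hDn : D ≤ n * T := hDT.trans (Nat.le_mul_of_pos_left T hn)
    have hcube : D ^ 2 * N ≤ (n * T) ^ 3 := by
      rw [pow_succ (n * T) 2]
      gcongr
    linarith [Nat.one_le_pow 3 (n * T) hnT]
  have hpoly' : 2 * ((D : ℝ) ^ 2 * N) + 1 ≤ 3 * (n * T) ^ 3 := by exact_mod_cast hpoly
  have hlog3 : Real.log 3 ≤ 3 - 1 := Real.log_le_sub_one_of_pos (by norm_num)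
  calc Real.log (2 * (D ^ 2 * N) + 1) ≤ Real.log (3 * (n * T) ^ 3) :=
        Real.log_le_log (by positivity) hpoly'
    _ = Real.log 3 + 3 * Real.log (n * T) := by
      rw [Real.log_mul (by norm_num) (by positivity), Real.log_pow, Nat.cast_ofNat]
    _ ≤ 3 * logFactor n T γ := by
      linarith [log_natCast_mul_add_one_le_logFactor hn hT hγ hγ1]

lemma noiseBudget_le {D N : ℕ} {B : ℝ} (hτ : 0 ≤ τ) (hB : 0 ≤ B) (hn : 1 ≤ n) (hT : 1 ≤ T)
    (hγ : 0 < γ) (hγ1 : γ ≤ 1) (hD : 1 ≤ D) (hDT : D ≤ T) (hN : N ≤ n * T) :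
    noiseBudget τ B D N ≤ (10 + τ * B * (4 + B)) * (D * logFactor n T γ) := by
  have hDl : 1 ≤ D * logFactor n T γ := one_le_mul_of_one_le_of_one_le (by exact_mod_cast hD)
    (one_le_logFactor hn hT hγ hγ1)
  have hlog := mul_le_mul_of_nonneg_left
    (log_two_mul_sq_mul_add_one_le hn hT hγ hγ1 hDT hN) (by positivity : (0 : ℝ) ≤ 3 * D)
  have hdisc := le_mul_of_one_le_right (by positivity : 0 ≤ τ * B * (4 + B)) hDl
  unfold noiseBudget
  linarith

lemma radius_le (hn : 1 ≤ n) (hγ : 0 < γ) (hγ1 : γ ≤ 1) (hd : 1 ≤ d) (ht : 1 ≤ t) (htT : t ≤ T) :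
    radius d n γ t ≤ 256 * d * logFactor n T γ ^ 2 := by
  have hT : 1 ≤ T := ht.trans htT
  have hd' : (1 : ℝ) ≤ d := by exact_mod_cast hd
  have hn' : (1 : ℝ) ≤ n := by exact_mod_cast hn
  have ht' : (1 : ℝ) ≤ t := by exact_mod_cast ht
  have htT' : (t : ℝ) ≤ T := by exact_mod_cast htT
  have hl := one_le_logFactor hn hT hγ hγ1
  have hlogt : Real.log t ≤ logFactor n T γ := by
    have hmono : Real.log t ≤ Real.log (n * T) := Real.log_le_log (by positivity)
      (htT'.trans (le_mul_of_one_le_left T.cast_nonneg hn'))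
    linarith [log_natCast_mul_add_one_le_logFactor hn hT hγ hγ1]
  have hnγ : 1 ≤ n / γ := (one_le_div hγ).2 (hγ1.trans hn')
  have hlog0 : 0 ≤ Real.log (n * t ^ 2 / γ) := Real.log_nonneg <| by
    rw [mul_div_right_comm]
    exact one_le_mul_of_one_le_of_one_le hnγ (one_le_pow₀ ht')
  have hlog : Real.log (n * t ^ 2 / γ) ≤ 2 * logFactor n T γ := by
    have hsq : n * t ^ 2 / γ ≤ (n * T / γ) ^ 2 := by
      rw [mul_div_right_comm, mul_div_right_comm, mul_pow]
      gcongr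
      exact le_self_pow₀ hnγ two_ne_zero
    calc Real.log (n * t ^ 2 / γ) ≤ Real.log ((n * T / γ) ^ 2) :=
          Real.log_le_log (by positivity) hsq
      _ = 2 * Real.log (n * T / γ) := by rw [Real.log_pow, Nat.cast_ofNat]
      _ ≤ 2 * logFactor n T γ := by
        rw [logFactor]
        linarith
  refine max_le ?_ ?_
  · calc 128 * d * Real.log t * Real.log (n * t ^ 2 / γ)
        ≤ 128 * d * logFactor n T γ * (2 * logFactor n T γ) := by gcongr
      _ = 256 * d * logFactor n T γ ^ 2 := by ring
  · calc (8 / 3 * Real.log (n * t ^ 2 / γ)) ^ 2 ≤ (8 / 3 * (2 * logFactor n T γ)) ^ 2 := by gcongr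
      _ ≤ 256 * d * logFactor n T γ ^ 2 := by nlinarith [sq_nonneg (logFactor n T γ)]

/-- The constant that `errorBudget` carries in front of `ε * l` when the noise budget is at most
`c * D * l` and `D / N` is at most `A * ε ^ 2`. -/
def errorConst (τ B K c A : ℝ) : ℝ := B + 2 * τ * B * (c * A) + K * (2 * B ^ 2 * A)

lemma errorConst_nonneg {B K c A : ℝ} (hτ : 0 ≤ τ) (hB : 0 ≤ B) (hK : 0 ≤ K) (hc : 0 ≤ c)
    (hA : 0 ≤ A) : 0 ≤ errorConst τ B K c A := by
  unfold errorConst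
  positivity

lemma errorBudget_le {B ε K g D N c A l : ℝ} (hτ : 0 ≤ τ) (hB : 0 ≤ B) (hε : 0 < ε) (hε1 : ε ≤ 1)
    (hK : 0 ≤ K) (hN : 0 < N) (hc : 0 ≤ c) (hA : 0 ≤ A) (hl : 1 ≤ l) (hg : g ≤ c * (D * l))
    (hDN : D / N ≤ A * ε ^ 2) : errorBudget τ B ε K g D N ≤ errorConst τ B K c A * (ε * l) := by
  have hεl : ε ≤ ε * l := le_mul_of_one_le_right hε.le hl
  have hnoise : 2 * τ * B / (ε * N) * g ≤ 2 * τ * B * (c * A) * (ε * l) :=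
    calc 2 * τ * B / (ε * N) * g ≤ 2 * τ * B / (ε * N) * (c * (D * l)) := by gcongr
      _ = 2 * τ * B / ε * (c * l) * (D / N) := by field_simp
      _ ≤ 2 * τ * B / ε * (c * l) * (A * ε ^ 2) := by gcongr
      _ = 2 * τ * B * (c * A) * (ε * l) := by field_simp
  have hbad : K * (2 * B ^ 2 * (D / N)) ≤ K * (2 * B ^ 2 * A) * (ε * l) :=
    calc K * (2 * B ^ 2 * (D / N)) ≤ K * (2 * B ^ 2 * (A * ε ^ 2)) := by gcongr
      _ = K * (2 * B ^ 2 * A) * ε ^ 2 := by ring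
      _ ≤ K * (2 * B ^ 2 * A) * (ε * l) := by
        gcongr
        exact (pow_le_of_le_one hε.le hε1 two_ne_zero).trans hεl
  rw [errorBudget, errorConst, add_mul, add_mul, mul_comm ε B]
  gcongr

/-- The constant in front of the excess cost of an exploitation round. -/
def exploitConst (τ KX KC Kμ KS κ : ℝ) : ℝ :=
  2 * (errorConst τ √(KX ^ 2 + 1) (|KC| + |Kμ|) (10 + τ * √(KX ^ 2 + 1) * (4 + √(KX ^ 2 + 1)))
      (2 * (4 * (κ + 1)) / KS) +
    (√(256 * (2 * 4 / KS)) +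
      errorConst τ 1 (|KC| + |Kμ|) (10 + τ * 1 * (4 + 1) + Kμ ^ 2 / 2) (2 * 4 / KS)))

lemma exploitConst_nonneg (hτ : 0 ≤ τ) (hKS : 0 < KS) (hκ : 0 ≤ κ) :
    0 ≤ exploitConst τ KX KC Kμ KS κ := by
  have hlabel : 0 ≤ errorConst τ √(KX ^ 2 + 1) (|KC| + |Kμ|)
      (10 + τ * √(KX ^ 2 + 1) * (4 + √(KX ^ 2 + 1))) (2 * (4 * (κ + 1)) / KS) :=
    errorConst_nonneg hτ (by positivity) (by positivity) (by positivity) (by positivity)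
  have hbandit : 0 ≤ errorConst τ 1 (|KC| + |Kμ|) (10 + τ * 1 * (4 + 1) + Kμ ^ 2 / 2)
      (2 * 4 / KS) :=
    errorConst_nonneg hτ (by positivity) (by positivity) (by positivity) (by positivity)
  unfold exploitConst
  positivity

lemma sqrt_radius_div_gramFloor_le (hKS : 0 < KS) (hm : 1 ≤ m) (hd : 1 ≤ d) (hn : 1 ≤ n)
    (hT₀ : 1 ≤ T₀) (hhalf : rate m d T / 2 ≤ T₀) (hγ : 0 < γ) (hγ1 : γ ≤ 1) (ht : 1 ≤ t)
    (htT : t ≤ T) :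
    √(radius d n γ t / gramFloor KS (m + d) T₀) ≤
      √(256 * (2 * 4 / KS)) * (rate m d T / T * logFactor n T γ) := by
  have hT : 1 ≤ T := ht.trans htT
  have hl := one_le_logFactor hn hT hγ hγ1
  have hfloor : 0 < gramFloor KS (m + d) T₀ := gramFloor_pos hKS (by positivity) (by positivity)
  have hρ := rate_nonneg m d T
  rw [← Real.sqrt_sq (by positivity : 0 ≤ rate m d T / T * logFactor n T γ),
    ← Real.sqrt_mul (by positivity)]
  refine Real.sqrt_le_sqrt ?_
  calc radius d n γ t / gramFloor KS (m + d) T₀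
      ≤ 256 * d * logFactor n T γ ^ 2 / gramFloor KS (m + d) T₀ := by
        gcongr
        exact radius_le hn hγ hγ1 hd ht htT
    _ = 256 * logFactor n T γ ^ 2 * (d / gramFloor KS (m + d) T₀) := by ring
    _ ≤ 256 * logFactor n T γ ^ 2 * (2 * 4 / KS * (rate m d T / T) ^ 2) := by
      gcongr
      exact dim_div_bandit_gramFloor_le hKS hm hd hT hT₀ hhalf
    _ = 256 * (2 * 4 / KS) * (rate m d T / T * logFactor n T γ) ^ 2 := by ring

lemma sum_Icc_le_of_le_of_lt {f : ℕ → ℝ} {a c : ℝ} (ha : 0 ≤ a) (hc : 0 ≤ c)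
    (hf : ∀ t ∈ Finset.Icc 1 T, f t ≤ a) (hf' : ∀ t ∈ Finset.Icc 1 T, T₀ < t → f t ≤ c) :
    ∑ t ∈ Finset.Icc 1 T, f t ≤ T₀ * a + T * c := by
  have hcard : ((Finset.Icc 1 T).filter (· ≤ T₀)).card ≤ T₀ := by
    refine (Finset.card_le_card (t := Finset.Icc 1 T₀) fun t ht => ?_).trans (by simp)
    simp only [Finset.mem_filter, Finset.mem_Icc] at ht ⊢
    exact ⟨ht.1.1, ht.2⟩
  calc ∑ t ∈ Finset.Icc 1 T, f t ≤ ∑ t ∈ Finset.Icc 1 T, ((if t ≤ T₀ then a else 0) + c) := by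
        refine Finset.sum_le_sum fun t ht => ?_
        split_ifs with h
        · exact (hf t ht).trans (le_add_of_nonneg_right hc)
        · simpa using hf' t ht (not_le.1 h)
    _ = ((Finset.Icc 1 T).filter (· ≤ T₀)).card * a + T * c := by
      simp [Finset.sum_add_distrib, ← Finset.sum_filter]
    _ ≤ T₀ * a + T * c := by gcongr

/-- The constant in front of the regret. -/
def regretConst (τ KX KC Kμ KS κ : ℝ) : ℝ :=
  16 * (|KC| + |Kμ|) + exploitConst τ KX KC Kμ KS κ

end Rate

section Regret

variable {m d n : ℕ} {Ω : Type*} {S : Primitives m d n Ω} {E : Env m d} {KX KC Kμ KS κ : ℝ}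
  {w : ℕ → Fin n → Ω → (Fin d → ℝ)} {b : Fin d → Fin d → ℝ} {γ : ℝ} {T₀ T t : ℕ}
  {π : (Fin m → ℝ) → (Fin d → ℝ)}

namespace IsRun

variable [MeasurableSpace Ω] {P : Measure Ω} [IsProbabilityMeasure P]

lemma integral_gap_exploit_le_rate (hrun : IsRun E S w b γ T₀ T) (hS : S.IsSample P E)
    (hE : E.IsRegular KX KC Kμ KS) (hπ : Measurable π) (hπW : ∀ x ∈ E.X, π x ∈ E.W)
    (hKS : 0 < KS) (hm : 1 ≤ m) (hd : 1 ≤ d) (hn : 1 ≤ n) (hκ : (m : ℝ) ≤ κ * n) (hκ0 : 0 ≤ κ)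
    (hγ : 0 < γ) (hγ1 : γ ≤ 1) (hT₀ : 1 ≤ T₀) (hhalf : rate m d T / 2 ≤ T₀)
    (hlong : 8 * rate m d T ≤ T) (ht₀ : T₀ < t) (ht : t ≤ T) (i : Fin n) :
    ∫ ω, E.gap (S.x t i ω) (w t i ω) (π (S.x t i ω)) ∂P ≤
      exploitConst E.tau KX KC Kμ KS κ * (rate m d T / T * logFactor n T γ) := by
  have ht1 : 1 ≤ t := hT₀.trans ht₀.le
  have hT : 1 ≤ T := ht1.trans ht
  have hdim := dim_le_of_eight_mul_rate_le hm hd hT hlong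
  have hρ := two_le_rate hm hd hT hlong
  have hε : 0 < rate m d T / T := by positivity
  have hε1 : rate m d T / T ≤ 1 := div_le_one_of_le₀ (by linarith) T.cast_nonneg
  have hτ : 0 ≤ E.tau := zero_le_one.trans E.one_le_tau
  have hl := one_le_logFactor hn hT hγ hγ1
  have hnoise : noiseBudget E.tau √(KX ^ 2 + 1) (m + d) (n * T) ≤
      (10 + E.tau * √(KX ^ 2 + 1) * (4 + √(KX ^ 2 + 1))) * ((m + d) * logFactor n T γ) := by
    rw [← Nat.cast_add]
    exact noiseBudget_le hτ (Real.sqrt_nonneg (KX ^ 2 + 1)) hn hT hγ hγ1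
      (hd.trans (Nat.le_add_left d m)) hdim le_rfl
  have hlabel := errorBudget_le (K := |KC| + |Kμ|) hτ (Real.sqrt_nonneg (KX ^ 2 + 1)) hε hε1
    (by positivity) (gramFloor_pos hKS (by positivity) (by positivity)) (by positivity)
    (by positivity) hl hnoise (dim_div_label_gramFloor_le hKS hm hd hn hT hT₀ hκ hhalf)
  have hridge : noiseBudget E.tau 1 d T + d * (Kμ ^ 2 / 2) ≤
      (10 + E.tau * 1 * (4 + 1) + Kμ ^ 2 / 2) * (d * logFactor n T γ) := by
    rw [add_mul, mul_comm (d : ℝ)]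
    gcongr
    · exact noiseBudget_le hτ zero_le_one hn hT hγ hγ1 hd ((Nat.le_add_left d m).trans hdim)
        (Nat.le_mul_of_pos_left T hn)
    · exact le_mul_of_one_le_right d.cast_nonneg hl
  have hbandit := errorBudget_le (K := |KC| + |Kμ|) hτ zero_le_one hε hε1 (by positivity)
    (gramFloor_pos hKS (by positivity) (by positivity)) (by positivity) (by positivity) hl hridge
    (dim_div_bandit_gramFloor_le hKS hm hd hT hT₀ hhalf)
  refine (hrun.integral_gap_exploit_le hS hE hπ hπW ht i hKS hd hn hT₀ ht₀ hε hε1).trans ?_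
  rw [exploitConst, mul_assoc, add_mul, add_mul]
  gcongr
  exact sqrt_radius_div_gramFloor_le hKS hm hd hn hT₀ hhalf hγ hγ1 ht1 ht

variable (hrun : IsRun E S w b γ T₀ T) (hS : S.IsSample P E) (hE : E.IsRegular KX KC Kμ KS)
  (hπ : Measurable π) (hπW : ∀ x ∈ E.X, π x ∈ E.W)

include hrun hS hE hπ hπW

lemma sum_integral_gap_le (ht : t ≤ T) :
    ∑ i, ∫ ω, E.gap (S.x t i ω) (w t i ω) (π (S.x t i ω)) ∂P ≤ n * (2 * (|KC| + |Kμ|)) := by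
  simpa using Finset.sum_le_card_nsmul Finset.univ _ _ fun i _ =>
    hrun.integral_gap_le hS hE hπ hπW ht i

lemma regret_le_of_le_eight_mul_rate (hshort : T ≤ 8 * rate m d T) :
    regret E S w P π T ≤ 16 * (|KC| + |Kμ|) * (rate m d T * n) := by
  rw [hrun.regret_eq_sum_integral_gap hS hE hπ hπW]
  calc ∑ t ∈ Finset.Icc 1 T, ∑ i, ∫ ω, E.gap (S.x t i ω) (w t i ω) (π (S.x t i ω)) ∂P
      ≤ T * (n * (2 * (|KC| + |Kμ|))) := by
        simpa using Finset.sum_le_card_nsmul (Finset.Icc 1 T) _ _ fun t ht =>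
          hrun.sum_integral_gap_le hS hE hπ hπW (Finset.mem_Icc.1 ht).2
    _ ≤ 8 * rate m d T * (n * (2 * (|KC| + |Kμ|))) := by gcongr
    _ = 16 * (|KC| + |Kμ|) * (rate m d T * n) := by ring

lemma regret_le_of_eight_mul_rate_le (hKS : 0 < KS) (hm : 1 ≤ m) (hd : 1 ≤ d) (hn : 1 ≤ n)
    (hT : 1 ≤ T) (hκ : (m : ℝ) ≤ κ * n) (hκ0 : 0 ≤ κ) (hγ : 0 < γ) (hγ1 : γ ≤ 1)
    (hT₀ : |(T₀ : ℝ) - rate m d T| < 1) (hlong : 8 * rate m d T ≤ T) :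
    regret E S w P π T ≤ 4 * (|KC| + |Kμ|) * (rate m d T * n) +
      exploitConst E.tau KX KC Kμ KS κ * logFactor n T γ * (rate m d T * n) := by
  have hρ := two_le_rate hm hd hT hlong
  have hhalf := half_rate_le hm hd hT hlong hT₀
  have hT₀pos : 1 ≤ T₀ := by exact_mod_cast (show (1 : ℝ) ≤ T₀ by linarith)
  have hC := exploitConst_nonneg (KX := KX) (KC := KC) (Kμ := Kμ)
    (zero_le_one.trans E.one_le_tau) hKS hκ0
  have hl := one_le_logFactor hn hT hγ hγ1
  rw [hrun.regret_eq_sum_integral_gap hS hE hπ hπW]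
  calc ∑ t ∈ Finset.Icc 1 T, ∑ i, ∫ ω, E.gap (S.x t i ω) (w t i ω) (π (S.x t i ω)) ∂P
      ≤ T₀ * (n * (2 * (|KC| + |Kμ|))) + T * (n * (exploitConst E.tau KX KC Kμ KS κ *
          (rate m d T / T * logFactor n T γ))) := by
        refine sum_Icc_le_of_le_of_lt (by positivity) (by positivity)
          (fun t ht => hrun.sum_integral_gap_le hS hE hπ hπW (Finset.mem_Icc.1 ht).2)
          fun t ht ht₀ => ?_
        simpa using Finset.sum_le_card_nsmul Finset.univ _ _ fun i _ =>
          hrun.integral_gap_exploit_le_rate hS hE hπ hπW hKS hm hd hn hκ hκ0 hγ hγ1 hT₀pos hhalf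
            hlong ht₀ (Finset.mem_Icc.1 ht).2 i
    _ ≤ 2 * rate m d T * (n * (2 * (|KC| + |Kμ|))) + T * (n * (exploitConst E.tau KX KC Kμ KS κ *
          (rate m d T / T * logFactor n T γ))) := by
        gcongr
        linarith [(abs_lt.1 hT₀).2]
    _ = 4 * (|KC| + |Kμ|) * (rate m d T * n) +
          exploitConst E.tau KX KC Kμ KS κ * logFactor n T γ * (rate m d T * n) := by
        field_simp
        ring

theorem regret_le (hKS : 0 < KS) (hm : 1 ≤ m) (hd : 1 ≤ d) (hn : 1 ≤ n) (hT : 1 ≤ T)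
    (hκ : (m : ℝ) ≤ κ * n) (hγ : 0 < γ) (hγ1 : γ ≤ 1) (hT₀ : |(T₀ : ℝ) - rate m d T| < 1) :
    regret E S w P π T ≤
      regretConst E.tau KX KC Kμ KS κ * logFactor n T γ * (rate m d T * n) := by
  have hκ0 : 0 ≤ κ := nonneg_of_mul_nonneg_left (m.cast_nonneg.trans hκ) (by positivity)
  have hC := exploitConst_nonneg (KX := KX) (KC := KC) (Kμ := Kμ)
    (zero_le_one.trans E.one_le_tau) hKS hκ0
  have hl := one_le_logFactor hn hT hγ hγ1
  have hρ := rate_nonneg m d T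
  have hexplore : 16 * (|KC| + |Kμ|) * (rate m d T * n) ≤
      16 * (|KC| + |Kμ|) * logFactor n T γ * (rate m d T * n) := by
    gcongr ?_ * (rate m d T * n)
    exact le_mul_of_one_le_right (by positivity) hl
  have hexploit : 0 ≤ exploitConst E.tau KX KC Kμ KS κ * logFactor n T γ * (rate m d T * n) := by
    positivity
  rw [regretConst, add_mul, add_mul]
  rcases le_total (T : ℝ) (8 * rate m d T) with hshort | hlong
  · linarith [hrun.regret_le_of_le_eight_mul_rate hS hE hπ hπW hshort]
  · have hpos : 0 ≤ (|KC| + |Kμ|) * (rate m d T * n) := by positivity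
    linarith [hrun.regret_le_of_eight_mul_rate_le hS hE hπ hπW hKS hm hd hn hT hκ hκ0 hγ hγ1 hT₀
      hlong]

end IsRun

end Regret

end PROOFBandit

end

theorem mainTheorem8_general :
    ∃ p : ℕ, ∀ (σ : ℝ≥0) (KX KC Kμ KS κ : ℝ), 0 < KS →
      ∃ C : ℝ, ∀ (m d n T T₀ : ℕ), 1 ≤ m → 1 ≤ d → 1 ≤ n → 1 ≤ T → (m : ℝ) ≤ κ * n →
        |(T₀ : ℝ) - (m : ℝ) ^ (1 / 3 : ℝ) * (d : ℝ) ^ (2 / 3 : ℝ) * (T : ℝ) ^ (2 / 3 : ℝ)| < 1 →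
        ∀ (γ : ℝ), 0 < γ → γ ≤ 1 →
        ∀ (E : PROOFBandit.Env m d), E.σ = σ → E.IsRegular KX KC Kμ KS →
        ∀ (π : (Fin m → ℝ) → (Fin d → ℝ)), Measurable π → (∀ x ∈ E.X, π x ∈ E.W) →
        ∀ (Ω : Type*) [MeasurableSpace Ω] (P : Measure Ω) [IsProbabilityMeasure P]
          (S : PROOFBandit.Primitives m d n Ω), S.IsSample P E →
        ∀ (b : Fin d → Fin d → ℝ) (w : ℕ → Fin n → Ω → (Fin d → ℝ)),
          PROOFBandit.IsRun E S w b γ T₀ T →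
          Integrable (PROOFBandit.excessCost E S w π T) P ∧
          PROOFBandit.regret E S w P π T ≤
            C * (1 + Real.log (n * T / γ)) ^ p *
              ((m : ℝ) ^ (1 / 3 : ℝ) * (d : ℝ) ^ (2 / 3 : ℝ) * n * (T : ℝ) ^ (2 / 3 : ℝ)) := by
  refine ⟨1, fun σ KX KC Kμ KS κ hKS =>
    ⟨PROOFBandit.regretConst ((σ : ℝ) ^ 2 + 1) KX KC Kμ KS κ, ?_⟩⟩
  rintro m d n T T₀ hm hd hn hT hκ hT₀ γ hγ hγ1 E rfl hE π hπ hπW Ω _ P _ S hS b w hrun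
  refine ⟨hrun.integrable_excessCost hS hE hπ hπW,
    (hrun.regret_le hS hE hπ hπW hKS hm hd hn hT hκ hγ hγ1 hT₀).trans_eq ?_⟩
  rw [PROOFBandit.Env.tau, PROOFBandit.logFactor, PROOFBandit.rate, pow_one]
  ring

theorem mainTheorem8 :
    ∃ p : ℕ, ∀ (σ : ℝ≥0) (KX KC Kμ KS κ : ℝ), 0 < KS →
      ∃ C : ℝ, ∀ (m d n T T₀ : ℕ), 1 ≤ m → 1 ≤ d → 1 ≤ n → 1 ≤ T → (m : ℝ) ≤ κ * n →
        |(T₀ : ℝ) - (m : ℝ) ^ (1 / 3 : ℝ) * (d : ℝ) ^ (2 / 3 : ℝ) * (T : ℝ) ^ (2 / 3 : ℝ)| < 1 →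
        ∀ (γ : ℝ), 0 < γ → γ ≤ 1 →
        ∀ (E : PROOFBandit.Env m d), E.σ = σ → E.IsRegular KX KC Kμ KS →
        ∀ (π : (Fin m → ℝ) → (Fin d → ℝ)), E.IsOptimalPolicy π →
        ∀ (Ω : Type*) [MeasurableSpace Ω] (P : Measure Ω) [IsProbabilityMeasure P]
          (S : PROOFBandit.Primitives m d n Ω), S.IsSample P E →
        ∀ (b : Fin d → Fin d → ℝ) (w : ℕ → Fin n → Ω → (Fin d → ℝ)),
          PROOFBandit.IsRun E S w b γ T₀ T →
          Integrable (PROOFBandit.excessCost E S w π T) P ∧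
          PROOFBandit.regret E S w P π T ≤
            C * (1 + Real.log (n * T / γ)) ^ p *
              ((m : ℝ) ^ (1 / 3 : ℝ) * (d : ℝ) ^ (2 / 3 : ℝ) * n * (T : ℝ) ^ (2 / 3 : ℝ)) := by
  refine mainTheorem8_general.imp fun p h σ KX KC Kμ KS κ hKS => (h σ KX KC Kμ KS κ hKS).imp ?_
  exact fun C hC m d n T T₀ hm hd hn hT hκ hT₀ γ hγ hγ1 E hσ hE π hπ =>
    hC m d n T T₀ hm hd hn hT hκ hT₀ γ hγ hγ1 E hσ hE π hπ.measurable hπ.mem
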